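/- Let $\mathbb T=\{(U,W)\in\mathbb R^3\times\mathbb R^3 : \langle U,W\rangle=0,\ |W|=1\}\cong TS^2=T\mathbb P^1$ be the space of oriented lines of $\mathbb R^3$, where $(U,W)$ stands for the line $\{U+rW : r\in\mathbb R\}$ oriented by $W$, with the complex structure $\mathbb J$ given by rotation through $90^\circ$ about the direction of the line. Let $\Sigma\subset\mathbb T$ be a globally convex line congruence, that is, the graph of a global section $V$ of class $C^2$ of $\pi:\mathbb T\to S^2=\mathbb P^1$, $\pi(U,W)=W$, and write $f:S^2\to\mathbb T$, $f(w)=(V(w),w)$. A congruence null frame near a point $p$ of a line $\gamma\in\Sigma$ consists of $e_0$ and $e_\pm=\frac1{\sqrt2}(e_1\mp ie_2)$, where $(e_0,e_1,e_2)$ is a $C^1$ positively oriented orthonormal frame field near $p$ such that $e_0(q)$ is, for every $q$ near $p$, the direction of a line of $\Sigma$ through $q$, and $e_0(p)$ is the direction of $\gamma$. The shear is $\sigma=\langle L_{e_0}e_+,e_+\rangle$ (inner product extended complex bilinearly). A line $\gamma\in\Sigma$ is shear-free if $\sigma$ vanishes along $\gamma$, that is, at all points of $\gamma$ near which a congruence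 null frame exists. A line $\gamma\in\Sigma$ is a complex point if $\mathbb J$ preserves $T_\gamma\Sigma$. The index of an isolated complex point $\gamma$ is the local intersection index with the zero section of $\delta^+f\wedge\delta^-f\in\Omega^2(S^2)\otimes\det T^{10}\mathbb T$, where $\delta^\pm f=\frac12(df\mp\mathbb J\circ df\circ j)$ and $j$ is the complex structure of $S^2$; that is, the winding number around $0$, along small positively oriented circles around $\pi(\gamma)$, of $\delta^+f\wedge\delta^-f$ read in a local trivialization. Suppose that the shear-free lines of $\Sigma$ are isolated, i.e. they form a discrete subset of $\Sigma$. Then a line of $\Sigma$ is shear-free if and only if it is a complex point of $\Sigma$; there are only finitely many shear-free lines; each of them has a well-defined index; and the sum of their indices is $4$. -/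

import Mathlib

open scoped Manifold ContDiff Topology

noncomputable section

namespace LineCongruence

/-- Euclidean three-space. -/
abbrev E3 : Type := EuclideanSpace ℝ (Fin 3)

/-- The unit sphere of directions, identified with the Riemann sphere by stereographic
projection. -/
abbrev S2 : Type := Metric.sphere (0 : E3) 1

instance factFinrank : Fact (Module.finrank ℝ E3 = 2 + 1) := ⟨by simp⟩

/-- The vector product of `ℝ³`. -/
def cross (u v : E3) : E3 := WithLp.toLp 2 (crossProduct u.ofLp v.ofLp)

/-- The space `𝕋 ≅ TS²` of oriented lines of `ℝ³`: pairs `(U, W)` with `⟨U, W⟩ = 0`, `|W| = 1`,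
representing the line `{U + r W | r ∈ ℝ}` oriented by `W`. It has the topology of `ℝ³ × ℝ³`. -/
abbrev OrientedLine : Type := {γ : E3 × E3 // inner ℝ γ.1 γ.2 = 0 ∧ ‖γ.2‖ = 1}

/-- The perpendicular displacement `U` of the line from the origin. -/
def OrientedLine.displacement (γ : OrientedLine) : E3 := γ.1.1

/-- The direction `W` of the line; this is the bundle projection `π : 𝕋 → S²`. -/
def OrientedLine.direction (γ : OrientedLine) : S2 :=
  ⟨γ.1.2, by simpa using γ.2.2⟩

/-- The points of `ℝ³` on the line. -/
def OrientedLine.points (γ : OrientedLine) : Set E3 :=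
  {p | ∃ r : ℝ, p = γ.displacement + r • (γ.direction : E3)}

/-! ### Shear -/

/-- `(e₀, e₁, e₂)` is a `C¹` positively oriented orthonormal frame field near the point `p` of the
line `γ`, with `e₀` the direction of `γ` at `p` and, at each nearby point, the direction of a line
of the congruence `C` through that point. The associated congruence null frame is
`e₀, e₊ = (e₁ - i e₂) / √2, e₋ = (e₁ + i e₂) / √2`. -/
structure IsCongruenceFrame (C : Set OrientedLine) (γ : OrientedLine) (p : E3)
    (e₀ e₁ e₂ : E3 → E3) : Prop where
  contDiff₀ : ContDiffAt ℝ 1 e₀ p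
  contDiff₁ : ContDiffAt ℝ 1 e₁ p
  contDiff₂ : ContDiffAt ℝ 1 e₂ p
  orthonormal : ∀ᶠ q in 𝓝 p, Orthonormal ℝ ![e₀ q, e₁ q, e₂ q]
  oriented : ∀ᶠ q in 𝓝 p, cross (e₀ q) (e₁ q) = e₂ q
  tangent : ∀ᶠ q in 𝓝 p, ∃ γ' ∈ C, q ∈ γ'.points ∧ e₀ q = γ'.direction
  base : e₀ p = γ.direction

/-- The shear `σ = ⟨L_{e₀} e₊, e₊⟩` (the inner product extended complex bilinearly), that is, the
`e₋`-coefficient of the Lie derivative `L_{e₀} e₊ = [e₀, e₊]`. With `e₊ = (e₁ - i e₂) / √2` it is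
`½ (⟨[e₀,e₁],e₁⟩ - ⟨[e₀,e₂],e₂⟩) - (i/2) (⟨[e₀,e₁],e₂⟩ + ⟨[e₀,e₂],e₁⟩)`. -/
def shear (e₀ e₁ e₂ : E3 → E3) (p : E3) : ℂ :=
  let L₁ : E3 := VectorField.lieBracket ℝ e₀ e₁ p
  let L₂ : E3 := VectorField.lieBracket ℝ e₀ e₂ p
  ((((inner ℝ L₁ (e₁ p) - inner ℝ L₂ (e₂ p) : ℝ)) : ℂ)
    - Complex.I * ((inner ℝ L₁ (e₂ p) + inner ℝ L₂ (e₁ p) : ℝ) : ℂ)) / 2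

/-- The lines of the congruence `C` along which the shear vanishes: at each point of the line
where a congruence frame exists (for the graph of a section these are all points of the line but
at most two focal points), the shear is zero. -/
def shearFreeLines (C : Set OrientedLine) : Set OrientedLine :=
  {γ | γ ∈ C ∧ ∀ p ∈ γ.points, ∀ e₀ e₁ e₂ : E3 → E3,
    IsCongruenceFrame C γ p e₀ e₁ e₂ → shear e₀ e₁ e₂ p = 0}

/-! ### Globally convex congruences -/

/-- A global section of class `C²` of the bundle `π : 𝕋 ≅ TS² → S²`. -/
structure GlobalSection where
  /-- The underlying vector field, with values in `ℝ³`. -/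
  toFun : S2 → E3
  contMDiff : ContMDiff (𝓡 2) 𝓘(ℝ, E3) 2 toFun
  tangent : ∀ w : S2, inner ℝ (toFun w) (w : E3) = 0

/-- Radial projection of `ℝ³ ∖ {0}` to the unit sphere (a fixed value is taken at `0`). -/
def normalize (x : E3) : S2 :=
  open Classical in
  if h : x = 0 then ⟨EuclideanSpace.single 0 1, by simp⟩
  else ⟨‖x‖⁻¹ • x, by simp [norm_smul, h]⟩

namespace GlobalSection

variable (V : GlobalSection)

/-- The line of the congruence with direction `w`. -/
def line (w : S2) : OrientedLine :=
  ⟨(V.toFun w, (w : E3)), V.tangent w, by simp⟩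

/-- The graph of the section: a globally convex line congruence. -/
def graph : Set OrientedLine := Set.range V.line

/-- The differential at `w` of the `ℝ³`-valued function `V` on the sphere, applied to a vector `x`
tangent to the sphere: the derivative of the radially constant extension of `V`. -/
def differential (w : S2) (x : E3) : E3 :=
  fderiv ℝ (fun y : E3 => V.toFun (normalize y)) (w : E3) x

/-- The tangent space at `(V w, w)` of the graph, a set of vectors of `ℝ³ × ℝ³`: the image of
the differential of `f : S² → 𝕋 ⊂ ℝ³ × ℝ³`, `f w = (V w, w)`. -/
def tangentSpace (w : S2) : Set (E3 × E3) :=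
  {v | ∃ x : E3, inner ℝ x (w : E3) = 0 ∧ v = (V.differential w x, x)}

end GlobalSection

/-- The complex structure `𝕁` of `𝕋` at `γ = (U, W)`: rotation through 90° about the direction of
the line. A tangent vector of `𝕋` at `γ` is a pair `(u, x)` with `⟨x, W⟩ = 0` and
`⟨u, W⟩ + ⟨U, x⟩ = 0`; the components of `u` and `x` normal to `W` are rotated, and the
`W`-component of the first entry is the one that makes the image tangent to `𝕋`. -/
def complexStructure (γ : OrientedLine) (v : E3 × E3) : E3 × E3 :=
  (cross γ.direction v.1 - inner ℝ γ.displacement (cross γ.direction v.2) • (γ.direction : E3),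
    cross γ.direction v.2)

/-- `(a, b)` is a continuous positively oriented orthonormal frame field of the tangent planes of
the sphere near `w₀` (so that rotation by 90° sends `a` to `b`). -/
structure IsTangentFrame (w₀ : S2) (a b : S2 → E3) : Prop where
  continuous_fst : ∀ᶠ w : S2 in 𝓝 w₀, ContinuousAt a w
  continuous_snd : ∀ᶠ w : S2 in 𝓝 w₀, ContinuousAt b w
  orthonormal : ∀ᶠ w : S2 in 𝓝 w₀, Orthonormal ℝ ![(w : E3), a w, b w]
  oriented : ∀ᶠ w : S2 in 𝓝 w₀, cross (w : E3) (a w) = b w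

/-- `g : ℝ → ℂ ∖ {0}` turns `n` times around `0` for `t` from `0` to `2π`. -/
def HasWindingNumber (g : ℝ → ℂ) (n : ℤ) : Prop :=
  (∀ t, g t ≠ 0) ∧ ∃ θ : ℝ → ℝ, Continuous θ ∧
    (∀ t, g t = (‖g t‖ : ℂ) * Complex.exp (θ t * Complex.I)) ∧
    θ (2 * Real.pi) - θ 0 = 2 * Real.pi * n

/-- A small circle on the sphere around `w₀`, run through in the direction from `a₀` to `b₀`. -/
def circleAround (w₀ : S2) (a₀ b₀ : E3) (ε t : ℝ) : S2 :=
  normalize ((w₀ : E3) + ε • (Real.cos t • a₀ + Real.sin t • b₀))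

namespace GlobalSection

variable (V : GlobalSection)

/-- The line with direction `w` is a complex point: `𝕁` preserves the tangent space there. -/
def IsComplexPoint (w : S2) : Prop :=
  ∀ v ∈ V.tangentSpace w, complexStructure (V.line w) v ∈ V.tangentSpace w

/-- The section `δ⁺f ∧ δ⁻f` of `Ω²(Σ) ⊗ det T¹⁰𝕋`, where `δ^± f = ½ (df ∓ 𝕁 ∘ df ∘ j)` and
`f w = (V w, w)`, as a complex number in the trivialization given by an oriented orthonormal frame
`(a, b)` of the tangent plane at `w`, namely `∂ξ ∂̄η - ∂̄ξ ∂η`. Here `(ξ, η)` are the complex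
linear coordinates `(u, x) ↦ (⟨x, a⟩ + i ⟨x, b⟩, ⟨u, a⟩ + i ⟨u, b⟩)` on the tangent space
of `𝕋`, composed with `df`, and `∂φ = ½ (φ(a) - i φ(b))`, `∂̄φ = ½ (φ(a) + i φ(b))`. -/
def complexDefect (w : S2) (a b : E3) : ℂ :=
  let z : E3 → ℂ := fun v => ((inner ℝ v a : ℝ) : ℂ) + ((inner ℝ v b : ℝ) : ℂ) * Complex.I
  let ξ : E3 → ℂ := fun x => z x
  let η : E3 → ℂ := fun x => z (V.differential w x)
  let del : (E3 → ℂ) → ℂ := fun φ => (φ a - Complex.I * φ b) / 2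
  let delbar : (E3 → ℂ) → ℂ := fun φ => (φ a + Complex.I * φ b) / 2
  del ξ * delbar η - delbar ξ * del η

/-- The isolated complex point of the graph with direction `w₀` has index `n`: the local
intersection index of `δ⁺f ∧ δ⁻f` with the zero section, that is, the winding number of
`δ⁺f ∧ δ⁻f`, read in a local trivialization, along all small circles around the point. The graph
carries the orientation of the sphere. -/
def HasIndex (w₀ : S2) (n : ℤ) : Prop :=
  ∃ a b : S2 → E3, IsTangentFrame w₀ a b ∧
    ∀ᶠ ε in 𝓝[>] (0 : ℝ), HasWindingNumber (fun t =>
      let w := circleAround w₀ (a w₀) (b w₀) ε t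
      V.complexDefect w (a w) (b w)) n

end GlobalSection

end LineCongruence

end

/-!
Write `D` for the differential of the section `V` at a direction `w`, extended by `D w = 0`. Two
facts carry the proof.

*Shear.* Near a point `p = V w + r w` of the line, the direction field `e₀` of a congruence frame
satisfies `V (e₀ q) = q - ⟨q, e₀ q⟩ e₀ q`. Differentiating this shows that, on the plane orthogonal
to `w`, the derivative of `e₀` is the inverse of `A + r`, with `A` the tangential part of `D`. The
shear is the trace-free symmetric part of the derivative of `e₀`, up to a constant, and a `2 × 2`
matrix is conformal exactly if its inverse is; so the shear at `p` vanishes if and only if the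
trace-free symmetric part of `A` does (`shear_eq_zero_iff_isComplexPoint`). That part is
`δ⁺f ∧ δ⁻f`, and its vanishing says that `D` commutes with the rotation by 90° up to the normal
component, that is, that `w` is a complex point (`isComplexPoint_iff_complexDefect`). A congruence
frame exists far out on each line, by the inverse function theorem (`exists_isCongruenceFrame`).
Complex points form a closed subset of the sphere, so isolated ones are finite in number.

*Index.* In a stereographic coordinate `ζ`, whose pole is not a complex point, the tangent plane
is spanned by the real and imaginary parts of the null vector `(1 - ζ²) u + i (1 + ζ²) v - 2 ζ n`.
Since `δ⁺f ∧ δ⁻f` is a complex quadratic form in this vector, it becomes a continuous function `G`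
of `ζ` with `G ζ / ζ⁴` convergent to a nonzero limit at infinity (`tendsto_stereoDefect`). A
continuous function on the plane with finitely many zeros and this growth has indices of sum `4`
(`sum_localIndex_eq`): after division by `∏ (ζ - b) ^ n b` all its zeros can be removed, so that it
has a logarithm. Finally the index of `G` at a zero is the winding number of `δ⁺f ∧ δ⁻f` along small
circles on the sphere in any oriented frame (`eventually_hasWindingNumber`). All winding numbers are
computed by exhibiting continuous logarithms.
-/

namespace LineCongruence

open Complex Set Filter

/-! ### Winding numbers of loops -/

/-- A continuous function with values in `2πiℤ` is constant on a preconnected set. -/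
theorem exists_int_of_preconnected {X : Type*} [TopologicalSpace X] {S : Set X}
    (hS : IsPreconnected S) {f : X → ℂ} (hf : ContinuousOn f S)
    (hn : ∀ x ∈ S, ∃ n : ℤ, f x = n * (2 * Real.pi * I)) :
    ∃ n : ℤ, ∀ x ∈ S, f x = n * (2 * Real.pi * I) := by
  have hdisc : IsDiscrete (range ((↑) : ℤ → ℝ)) :=
    isDiscrete_iff_discreteTopology.2
      Int.isClosedEmbedding_coe_real.isEmbedding.toHomeomorph.symm.isEmbedding.discreteTopology
  have hcont : ContinuousOn (fun x => (f x / (2 * Real.pi * I)).re) S :=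
    continuous_re.comp_continuousOn (hf.div_const _)
  have hmaps : MapsTo (fun x => (f x / (2 * Real.pi * I)).re) S (range ((↑) : ℤ → ℝ)) := by
    intro x hx
    obtain ⟨n, h⟩ := hn x hx
    refine ⟨n, ?_⟩
    simp only [h]
    rw [mul_div_cancel_right₀ _ two_pi_I_ne_zero, intCast_re]
  obtain ⟨y, ⟨n, rfl⟩, hy⟩ := hS.eqOn_const_of_mapsTo hdisc hcont hmaps ⟨_, ⟨0, rfl⟩⟩
  refine ⟨n, fun x hx => ?_⟩
  obtain ⟨m, h⟩ := hn x hx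
  have h2 := hy hx
  simp only [h, Function.const_apply] at h2
  rw [mul_div_cancel_right₀ _ two_pi_I_ne_zero, intCast_re] at h2
  rw [h, Int.cast_injective h2]

theorem HasWindingNumber.of_exp {g : ℝ → ℂ} {n : ℤ} {L : ℝ → ℂ} (hL : Continuous L)
    (hg : ∀ t, g t = exp (L t))
    (hn : L (2 * Real.pi) - L 0 = n * (2 * Real.pi * I)) : HasWindingNumber g n := by
  refine ⟨fun t => by rw [hg]; exact exp_ne_zero _, fun t => (L t).im,
    continuous_im.comp hL, fun t => ?_, ?_⟩
  · rw [hg, norm_exp, ofReal_exp, ← Complex.exp_add, re_add_im]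
  · have := congrArg Complex.im hn
    simp at this
    linarith

theorem HasWindingNumber.unique {g : ℝ → ℂ} {n m : ℤ} (hn : HasWindingNumber g n)
    (hm : HasWindingNumber g m) : n = m := by
  obtain ⟨h0, θ, hθ, hgθ, hθn⟩ := hn
  obtain ⟨-, φ, hφ, hgφ, hφm⟩ := hm
  obtain ⟨k, hk⟩ := exists_int_of_preconnected (X := ℝ) isPreconnected_univ
    (f := fun t => θ t * I - φ t * I) (by fun_prop) (fun t _ => by
      have h1 := (hgθ t).symm.trans (hgφ t)
      have h2 := mul_left_cancel₀ (by simpa using h0 t) h1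
      obtain ⟨j, hj⟩ := exp_eq_exp_iff_exists_int.1 h2
      exact ⟨j, by rw [hj]; ring⟩)
  have e1 := congrArg Complex.im (hk (2 * Real.pi) (mem_univ _))
  have e0 := congrArg Complex.im (hk 0 (mem_univ _))
  simp at e1 e0
  have : (2 * Real.pi) * (n : ℝ) = 2 * Real.pi * m := by linarith
  exact_mod_cast mul_left_cancel₀ (by positivity) this

/-! ### Local index of a function of a complex variable -/

/-- The function `G` has index `n` at `z₀`: on a punctured disc around `z₀` it has no zeros and,
in the logarithmic coordinate `s` with `z = z₀ + exp s`, it has a continuous logarithm `L` on a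
left half-plane, which grows by `2πin` when `s` grows by `2πi`. -/
def HasLocalIndex (G : ℂ → ℂ) (z₀ : ℂ) (n : ℤ) : Prop :=
  ∃ (ρ : ℝ) (L : ℂ → ℂ), ContinuousOn L {s | s.re < ρ} ∧
    ∀ s : ℂ, s.re < ρ → G (z₀ + exp s) = exp (L s) ∧
      L (s + 2 * Real.pi * I) = L s + n * (2 * Real.pi * I)

theorem isSimplyConnected_of_convex {U : Set ℂ} (hU : Convex ℝ U) (hne : U.Nonempty) :
    IsSimplyConnected U := by
  have := hU.contractibleSpace hne
  exact (inferInstance : SimplyConnectedSpace U)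

theorem exists_forall_add_exp {P : ℂ → Prop} {z₀ : ℂ} (h : ∀ᶠ z in 𝓝[≠] z₀, P z) :
    ∃ ρ : ℝ, ∀ s : ℂ, s.re < ρ → P (z₀ + exp s) := by
  obtain ⟨r, hr, h⟩ := Metric.mem_nhdsWithin_iff.1 h
  refine ⟨Real.log r, fun s hs => h ⟨?_, by simp⟩⟩
  rw [Metric.mem_ball, dist_self_add_left, norm_exp]
  exact (Real.lt_log_iff_exp_lt hr).1 hs

/-- A continuous function without zeros on a punctured disc has an index at the centre. -/
theorem exists_hasLocalIndex {G : ℂ → ℂ} {z₀ : ℂ}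
    (hG : ∀ᶠ z in 𝓝[≠] z₀, ContinuousAt G z ∧ G z ≠ 0) : ∃ n, HasLocalIndex G z₀ n := by
  obtain ⟨ρ, key⟩ := exists_forall_add_exp hG
  have hconv : Convex ℝ {s : ℂ | s.re < ρ} := convex_halfSpace_re_lt _
  have hne : {s : ℂ | s.re < ρ}.Nonempty :=
    ⟨((ρ - 1 : ℝ) : ℂ), by simp⟩
  have hcont : ContinuousOn (fun s => G (z₀ + exp s)) {s : ℂ | s.re < ρ} := by
    intro s hs
    exact ((key s hs).1.comp (f := fun s => z₀ + exp s)
      (by fun_prop)).continuousWithinAt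
  obtain ⟨L, hL, hexp⟩ := exists_continuousOn_eqOn_exp_comp
    (isSimplyConnected_of_convex hconv hne) (isOpen_lt continuous_re continuous_const) hcont
    (by rintro ⟨s, hs, h0⟩; exact (key s hs).2 h0)
  have hmaps : MapsTo (fun s : ℂ => s + 2 * Real.pi * I) {s : ℂ | s.re < ρ}
      {s : ℂ | s.re < ρ} := fun s hs => by simpa using hs
  obtain ⟨n, hn⟩ := exists_int_of_preconnected hconv.isPreconnected
    (f := fun s => L (s + 2 * Real.pi * I) - L s)
    ((hL.comp (by fun_prop) hmaps).sub hL) (fun s hs => by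
      have e1 := hexp (hmaps hs)
      have e2 := hexp hs
      simp only [Function.comp_apply] at e1 e2
      rw [exp_periodic s, ← e2] at e1
      obtain ⟨j, hj⟩ := exp_eq_exp_iff_exists_int.1 e1
      exact ⟨j, by rw [hj]; ring⟩)
  refine ⟨n, ρ, L, hL, fun s hs => ⟨(hexp hs).symm, ?_⟩⟩
  rw [← hn s hs]; ring

theorem HasLocalIndex.mul {G H : ℂ → ℂ} {z₀ : ℂ} {n m : ℤ} (hG : HasLocalIndex G z₀ n)
    (hH : HasLocalIndex H z₀ m) : HasLocalIndex (fun z => G z * H z) z₀ (n + m) := by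
  obtain ⟨ρ, L, hL, h⟩ := hG
  obtain ⟨τ, K, hK, k⟩ := hH
  refine ⟨min ρ τ, fun s => L s + K s, ?_, fun s hs => ?_⟩
  · exact (hL.mono fun s hs => lt_of_lt_of_le (show s.re < min _ _ from hs) (min_le_left _ _)).add
      (hK.mono fun s hs => lt_of_lt_of_le (show s.re < min _ _ from hs) (min_le_right _ _))
  · obtain ⟨h1, h2⟩ := h s (lt_of_lt_of_le hs (min_le_left _ _))
    obtain ⟨k1, k2⟩ := k s (lt_of_lt_of_le hs (min_le_right _ _))
    refine ⟨by simp only [h1, k1, Complex.exp_add], ?_⟩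
    simp only [h2, k2]
    push_cast; ring

theorem hasLocalIndex_zpow (z₀ : ℂ) (n : ℤ) : HasLocalIndex (fun z => (z - z₀) ^ n) z₀ n := by
  refine ⟨0, fun s => n * s, by fun_prop, fun s _ => ⟨?_, by ring⟩⟩
  simp only [add_sub_cancel_left]
  rw [exp_int_mul]

/-- At a point near which it is continuous and where it does not vanish, a function has
index `0`. -/
theorem hasLocalIndex_zero {G : ℂ → ℂ} {z₀ : ℂ} (hG : ∀ᶠ z in 𝓝 z₀, ContinuousAt G z)
    (h0 : G z₀ ≠ 0) : HasLocalIndex G z₀ 0 := by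
  have hslit : ∀ᶠ z in 𝓝 z₀, G z / G z₀ ∈ slitPlane := by
    have : ContinuousAt (fun z => G z / G z₀) z₀ := hG.self_of_nhds.div_const _
    refine this.eventually_mem (isOpen_slitPlane.mem_nhds ?_)
    simp [h0]
  obtain ⟨ρ, h⟩ := exists_forall_add_exp ((hG.and hslit).filter_mono nhdsWithin_le_nhds)
  refine ⟨ρ, fun s => log (G z₀) + log (G (z₀ + exp s) / G z₀), ?_, fun s hs => ⟨?_, ?_⟩⟩
  · refine continuousOn_const.add (ContinuousOn.clog ?_ fun s hs => (h s hs).2)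
    refine ContinuousOn.div_const (fun s hs => ?_) _
    exact ((h s hs).1.comp (f := fun s => z₀ + exp s) (by fun_prop)).continuousWithinAt
  · rw [Complex.exp_add, exp_log h0, exp_log (slitPlane_ne_zero (h s hs).2)]
    field_simp
  · simp [exp_periodic s]

/-- The index is the growth of the logarithm along any small loop `z₀ + exp σ` that winds once
around the point, not only along round circles. -/
theorem HasLocalIndex.exists_log_along {G : ℂ → ℂ} {z₀ : ℂ} {n : ℤ} (hG : HasLocalIndex G z₀ n) :
    ∃ ρ : ℝ, ∀ σ : ℝ → ℂ, Continuous σ → (∀ t, (σ t).re < ρ) →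
      σ (2 * Real.pi) = σ 0 + 2 * Real.pi * I →
      ∃ L : ℝ → ℂ, Continuous L ∧ (∀ t, G (z₀ + exp (σ t)) = exp (L t)) ∧
        L (2 * Real.pi) = L 0 + n * (2 * Real.pi * I) := by
  obtain ⟨ρ, L, hL, h⟩ := hG
  refine ⟨ρ, fun σ hσ hre hper => ⟨L ∘ σ, hL.comp_continuous hσ hre,
    fun t => (h _ (hre t)).1, ?_⟩⟩
  simp only [Function.comp_apply, hper, (h _ (hre 0)).2]

/-- A singularity of index `0` can be removed by changing the function on a small disc: on a small
circle the function has a continuous logarithm, which extends to the disc by Tietze's theorem. -/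
theorem HasLocalIndex.exists_extension {H : ℂ → ℂ} {z₀ : ℂ} {Z : Set ℂ} (hZ : IsClosed Z)
    (hz₀ : z₀ ∉ Z) (hc : ContinuousOn H (insert z₀ Z)ᶜ) (hne : ∀ z ∉ insert z₀ Z, H z ≠ 0)
    (hind : HasLocalIndex H z₀ 0) {δ : ℝ} (hδ : 0 < δ) :
    ∃ H' : ℂ → ℂ, ContinuousOn H' Zᶜ ∧ (∀ z ∉ Z, H' z ≠ 0) ∧
      ∀ z, δ < dist z z₀ → H' z = H z := by
  classical
  obtain ⟨ρ, L, hL, h⟩ := hind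
  obtain ⟨r₁, hr₁, hball⟩ := Metric.isOpen_iff.1 hZ.isOpen_compl z₀ hz₀
  obtain ⟨r, hr0, hr⟩ : ∃ r : ℝ, 0 < r ∧ r < min (min δ r₁) (Real.exp ρ) :=
    exists_between (by positivity)
  have hr1 : r < δ := hr.trans_le ((min_le_left _ _).trans (min_le_left _ _))
  have hrr : r < r₁ := hr.trans_le ((min_le_left _ _).trans (min_le_right _ _))
  have hrρ : r < Real.exp ρ := hr.trans_le (min_le_right _ _)
  have hper : ∀ (k : ℤ) (s : ℂ), s.re < ρ → L (s + k * (2 * Real.pi * I)) = L s := by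
    intro k
    induction k using Int.induction_on with
    | zero => simp
    | succ k ih =>
      intro s hs
      have h1 := (h (s + (k : ℤ) * (2 * Real.pi * I)) (by simpa using hs)).2
      rw [ih s hs] at h1
      simp only [Int.cast_zero, zero_mul, add_zero] at h1
      rw [← h1]; congr 1; push_cast; ring
    | pred k ih =>
      intro s hs
      have h1 := (h (s + (-(k : ℤ) - 1 : ℤ) * (2 * Real.pi * I)) (by simpa using hs)).2
      simp only [Int.cast_zero, zero_mul, add_zero] at h1
      rw [← h1, ← ih s hs]; congr 1; push_cast; ring
  -- On the circle of radius `r` the logarithm descends from the half-plane to the plane.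
  have hlogre : ∀ z : ℂ, z ∈ Metric.sphere z₀ r → (log (z - z₀)).re < ρ := by
    intro z hz
    rw [log_re, ← dist_eq, Metric.mem_sphere.1 hz]
    exact (Real.log_lt_iff_lt_exp hr0).2 hrρ
  have hℓ : ContinuousOn (fun z => L (log (z - z₀))) (Metric.sphere z₀ r) := by
    intro z hz
    have hz0 : z - z₀ ≠ 0 := by
      rw [sub_ne_zero]; exact Metric.ne_of_mem_sphere hz hr0.ne'
    have hopen : IsOpen {s : ℂ | s.re < ρ} := isOpen_lt continuous_re continuous_const
    by_cases hs : z - z₀ ∈ slitPlane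
    · have h1 : ContinuousAt L (log (z - z₀)) := hL.continuousAt (hopen.mem_nhds (hlogre z hz))
      exact (ContinuousAt.comp (f := fun z => log (z - z₀)) h1
        ((continuousAt_id.sub continuousAt_const).clog hs)).continuousWithinAt
    · have hs' : -(z - z₀) ∈ slitPlane := by
        rw [mem_slitPlane_iff] at hs ⊢
        push Not at hs
        left
        rcases hs.1.lt_or_eq with h | h
        · simpa using h
        · exact absurd (Complex.ext h hs.2) hz0
      -- Across the slit the logarithm is replaced by another branch.
      have hre : ∀ y ∈ Metric.sphere z₀ r, (log (-(y - z₀)) + Real.pi * I).re < ρ := by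
        intro y hy
        have := hlogre y hy
        rw [log_re] at this
        simpa [log_re, norm_sub_rev] using this
      have h1 : ContinuousAt L (log (-(z - z₀)) + Real.pi * I) :=
        hL.continuousAt (hopen.mem_nhds (hre z hz))
      have h2 : ContinuousAt (fun z => log (-(z - z₀)) + Real.pi * I) z :=
        ((continuousAt_id.sub continuousAt_const).neg.clog hs').add continuousAt_const
      refine (ContinuousAt.comp (f := fun z => log (-(z - z₀)) + Real.pi * I) h1
        h2).continuousWithinAt.congr (fun y hy => ?_) ?_
      all_goals
        have aux : ∀ y ∈ Metric.sphere z₀ r,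
            L (log (y - z₀)) = L (log (-(y - z₀)) + Real.pi * I) := by
          intro y hy
          have hy0 : y - z₀ ≠ 0 := by
            rw [sub_ne_zero]; exact Metric.ne_of_mem_sphere hy hr0.ne'
          have he : exp (log (y - z₀)) = exp (log (-(y - z₀)) + Real.pi * I) := by
            rw [Complex.exp_add, exp_log hy0, exp_log (neg_ne_zero.2 hy0), exp_pi_mul_I]; ring
          obtain ⟨k, hk⟩ := exp_eq_exp_iff_exists_int.1 he
          rw [hk, hper k _ (hre y hy)]
      · exact aux y hy
      · exact aux z hz
  obtain ⟨ℓ, hℓ'⟩ := ContinuousMap.exists_restrict_eq (Metric.isClosed_sphere (x := z₀) (ε := r))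
    ⟨_, hℓ.domRestrict⟩
  have hℓeq : ∀ z ∈ Metric.sphere z₀ r, exp (ℓ z) = H z := by
    intro z hz
    have h1 : ℓ z = L (log (z - z₀)) := congrArg (fun f => f ⟨z, hz⟩) hℓ'
    have hz0 : z - z₀ ≠ 0 := by
      rw [sub_ne_zero]; exact Metric.ne_of_mem_sphere hz hr0.ne'
    rw [h1, ← (h _ (hlogre z hz)).1, exp_log hz0, add_sub_cancel]
  have hcl : closure {z | ¬ dist z z₀ ≤ r} ⊆ {z | r ≤ dist z z₀} :=
    closure_minimal (fun z hz => (not_le.1 hz).le)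
      (isClosed_le continuous_const (continuous_id.dist continuous_const))
  refine ⟨fun z => if dist z z₀ ≤ r then exp (ℓ z) else H z, ?_, fun z hz => ?_, fun z hz => ?_⟩
  · refine ContinuousOn.if (fun z hz => ?_) ?_ ?_
    · refine hℓeq z ?_
      have := hz.2
      exact Metric.frontier_closedBall_subset_sphere this
    · exact (continuous_exp.comp ℓ.continuous).continuousOn
    · refine hc.mono fun z hz => ?_
      have h1 : r ≤ dist z z₀ := hcl hz.2
      rintro (rfl | h2)
      · rw [dist_self] at h1; exact absurd h1 (not_le.2 hr0)
      · exact hz.1 h2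
  · dsimp only
    split_ifs with hd
    · exact exp_ne_zero _
    · refine hne z ?_
      rintro (rfl | h2)
      · exact hd (by rw [dist_self]; exact hr0.le)
      · exact hz h2
  · exact if_neg (not_le.2 (hr1.trans hz))

theorem HasLocalIndex.congr {G H : ℂ → ℂ} {z₀ : ℂ} {n : ℤ} (hG : HasLocalIndex G z₀ n)
    (h : ∀ᶠ z in 𝓝[≠] z₀, H z = G z) : HasLocalIndex H z₀ n := by
  obtain ⟨r, h⟩ := exists_forall_add_exp h
  obtain ⟨ρ, L, hL, hG⟩ := hG
  refine ⟨min ρ r, L,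
    hL.mono fun s hs => lt_of_lt_of_le (show s.re < min _ _ from hs) (min_le_left _ _),
    fun s hs => ?_⟩
  obtain ⟨h1, h2⟩ := hG s (lt_of_lt_of_le hs (min_le_left _ _))
  exact ⟨(h s (lt_of_lt_of_le hs (min_le_right _ _))).trans h1, h2⟩

/-- Finitely many singularities of index `0` can be removed by changing the function on a bounded
set. -/
theorem exists_extension_of_hasLocalIndex_zero (Z : Finset ℂ) : ∀ {H : ℂ → ℂ},
    ContinuousOn H (Z : Set ℂ)ᶜ → (∀ z ∉ Z, H z ≠ 0) → (∀ z ∈ Z, HasLocalIndex H z 0) →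
    ∃ H' : ℂ → ℂ, Continuous H' ∧ (∀ z, H' z ≠ 0) ∧ ∀ᶠ z in cocompact ℂ, H' z = H z := by
  classical
  induction Z using Finset.induction_on with
  | empty =>
    intro H hc hne _
    exact ⟨H, by simpa [← continuousOn_univ] using hc, by simpa using hne, .of_forall fun _ => rfl⟩
  | insert z₀ Z hz₀ ih =>
    intro H hc hne hind
    have hcl : IsClosed (Z : Set ℂ) := Z.finite_toSet.isClosed
    have hz₀' : z₀ ∉ (Z : Set ℂ) := by simpa using hz₀
    rw [Finset.coe_insert] at hc
    obtain ⟨r, hr, hball⟩ := Metric.isOpen_iff.1 hcl.isOpen_compl z₀ hz₀'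
    obtain ⟨H₁, hc₁, hne₁, heq⟩ := (hind z₀ (by simp)).exists_extension hcl hz₀' hc
      (fun z hz => hne z (by simpa using hz)) (half_pos hr)
    obtain ⟨H₂, hc₂, hne₂, heq₂⟩ := ih hc₁ (by simpa using hne₁) (fun z hz => by
      have hfar : r ≤ dist z z₀ := by
        by_contra hlt
        exact hball (Metric.mem_ball.2 (not_le.1 hlt)) hz
      refine (hind z (by simp [hz])).congr (Filter.Eventually.filter_mono nhdsWithin_le_nhds ?_)
      have : ∀ᶠ y in 𝓝 z, r / 2 < dist y z₀ :=
        (continuous_id.dist continuous_const).continuousAt.eventually_const_lt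
          (by simp only [id]; linarith)
      exact this.mono heq)
    refine ⟨H₂, hc₂, hne₂, ?_⟩
    have : ∀ᶠ z in cocompact ℂ, r / 2 < dist z z₀ := by
      filter_upwards [(isCompact_closedBall z₀ (r / 2)).compl_mem_cocompact] with z hz
      simpa using hz
    filter_upwards [this, heq₂] with z h1 h2
    rw [h2, heq z h1]

/-- A function without zeros on the plane has a continuous logarithm, hence winding number `0` along
every closed curve, while one that is asymptotic to `c z ^ m` winds `m` times along large
circles. -/
theorem exponent_eq_zero_of_tendsto {H : ℂ → ℂ} (hH : Continuous H) (hne : ∀ z, H z ≠ 0) {m : ℤ}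
    {c : ℂ} (hc : c ≠ 0) (hlim : Tendsto (fun z => H z / z ^ m) (cocompact ℂ) (𝓝 c)) : m = 0 := by
  obtain ⟨L, hL, hexp⟩ := exists_continuousOn_eqOn_exp_comp
    (isSimplyConnected_of_convex convex_univ univ_nonempty) isOpen_univ hH.continuousOn
    (by rintro ⟨s, -, h0⟩; exact hne s h0)
  have hslit : ∀ᶠ z in cocompact ℂ, H z / z ^ m / c ∈ slitPlane := by
    refine (hlim.div_const c).eventually_mem (isOpen_slitPlane.mem_nhds ?_)
    simp [hc]
  obtain ⟨ρ, hρ⟩ : ∃ ρ : ℝ, ∀ s : ℂ, s.re = ρ → H (exp s) / exp s ^ m / c ∈ slitPlane := by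
    rw [← Metric.cobounded_eq_cocompact, ← comap_norm_atTop, eventually_comap] at hslit
    obtain ⟨ρ, hρ⟩ := (Real.tendsto_exp_atTop.eventually hslit).exists
    exact ⟨ρ, fun s hs => hρ _ (by rw [norm_exp, hs])⟩
  set σ : ℝ → ℂ := fun t => ρ + t * I with hσ
  have hσc : Continuous σ := by fun_prop
  have hσre : ∀ t, (σ t).re = ρ := fun t => by simp [hσ]
  have hper : exp (σ (2 * Real.pi)) = exp (σ 0) := by
    have : σ (2 * Real.pi) = σ 0 + 2 * Real.pi * I := by simp [hσ]
    rw [this, exp_periodic]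
  refine HasWindingNumber.unique (g := fun t => H (exp (σ t))) (HasWindingNumber.of_exp
    (L := fun t => m * σ t + log c + log (H (exp (σ t)) / exp (σ t) ^ m / c)) ?_ (fun t => ?_) ?_)
    (HasWindingNumber.of_exp (L := fun t => L (exp (σ t))) ?_ (fun t => ?_) ?_)
  · refine (by fun_prop : Continuous fun t => m * σ t + log c).add ?_
    refine Continuous.clog ?_ fun t => hρ _ (hσre t)
    refine Continuous.div_const (Continuous.div (by fun_prop) ?_ ?_) _
    · exact Continuous.zpow₀ (by fun_prop) _ fun t => Or.inl (exp_ne_zero _)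
    · exact fun t => zpow_ne_zero _ (exp_ne_zero _)
  · rw [Complex.exp_add (_ + _), Complex.exp_add (m * σ t), exp_log hc,
      exp_log (slitPlane_ne_zero (hρ _ (hσre t))), exp_int_mul]
    have := zpow_ne_zero m (exp_ne_zero (σ t))
    field_simp
  · simp only [hper]
    simp [hσ]; ring
  · exact (continuousOn_univ.1 hL).comp (by fun_prop)
  · exact (hexp (mem_univ _)).symm
  · simp [hper]

/-- **Argument principle for continuous functions.** If `G` is asymptotic to `c z ^ k` at
infinity, then its local indices add up to `k`. Dividing by `∏ (z - b) ^ n b` reduces this to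
indices that are all `0`, and such singularities can be removed. -/
theorem sum_localIndex_eq {G : ℂ → ℂ} {Z : Finset ℂ} (hG : ContinuousOn G (Z : Set ℂ)ᶜ)
    (hne : ∀ z ∉ Z, G z ≠ 0) {n : ℂ → ℤ} (hind : ∀ z ∈ Z, HasLocalIndex G z (n z)) {k : ℤ} {c : ℂ}
    (hc : c ≠ 0) (hlim : Tendsto (fun z => G z / z ^ k) (cocompact ℂ) (𝓝 c)) :
    ∑ z ∈ Z, n z = k := by
  classical
  have hprod : ∀ (S : Finset ℂ) (a : ℂ), a ∉ S → ∀ᶠ z in 𝓝 a,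
      ContinuousAt (fun z => ∏ b ∈ S, (z - b) ^ (-n b)) z := by
    intro S a ha
    have : ∀ᶠ z in 𝓝 a, z ∉ S :=
      S.finite_toSet.isClosed.isOpen_compl.mem_nhds (by simpa using ha)
    filter_upwards [this] with z hz
    refine tendsto_finsetProd _ fun b hb => ?_
    refine ContinuousAt.zpow₀ (by fun_prop) _ (Or.inl (sub_ne_zero.2 ?_))
    rintro rfl; exact hz hb
  have hcont : ContinuousOn (fun z => G z * ∏ b ∈ Z, (z - b) ^ (-n b)) (Z : Set ℂ)ᶜ := by
    intro z hz
    exact ((hG z hz).continuousAt (Z.finite_toSet.isClosed.isOpen_compl.mem_nhds hz)).mul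
      (hprod Z z (by simpa using hz)).self_of_nhds |>.continuousWithinAt
  have hnz : ∀ z ∉ Z, G z * ∏ b ∈ Z, (z - b) ^ (-n b) ≠ 0 := by
    intro z hz
    refine mul_ne_zero (hne z hz) (Finset.prod_ne_zero_iff.2 fun b hb => zpow_ne_zero _ ?_)
    rw [sub_ne_zero]; rintro rfl; exact hz hb
  have hzero : ∀ a ∈ Z, HasLocalIndex (fun z => G z * ∏ b ∈ Z, (z - b) ^ (-n b)) a 0 := by
    intro a ha
    have h0 : ∏ b ∈ Z.erase a, (a - b) ^ (-n b) ≠ 0 :=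
      Finset.prod_ne_zero_iff.2 fun b hb =>
        zpow_ne_zero _ (sub_ne_zero.2 (Finset.ne_of_mem_erase hb).symm)
    have h1 := ((hind a ha).mul (hasLocalIndex_zpow a (-n a))).mul
      (hasLocalIndex_zero (hprod (Z.erase a) a (by simp)) h0)
    rw [add_neg_cancel, add_zero] at h1
    refine h1.congr (.of_forall fun z => ?_)
    rw [← Finset.mul_prod_erase Z _ ha, mul_assoc]
  obtain ⟨H', hc', hne', heq⟩ := exists_extension_of_hasLocalIndex_zero Z hcont hnz hzero
  have := exponent_eq_zero_of_tendsto hc' hne' (m := k - ∑ z ∈ Z, n z) hc ?_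
  · omega
  have hfac : ∀ b : ℂ, Tendsto (fun z : ℂ => ((z - b) / z) ^ (-n b)) (cocompact ℂ) (𝓝 1) := by
    intro b
    have h1 : Tendsto (fun z : ℂ => 1 - b * z⁻¹) (cocompact ℂ) (𝓝 (1 - b * 0)) :=
      (tendsto_inv₀_cobounded.mono_left
        (Metric.cobounded_eq_cocompact (α := ℂ)).ge |>.const_mul b).const_sub 1
    have h2 : Tendsto (fun z : ℂ => (z - b) / z) (cocompact ℂ) (𝓝 1) := by
      rw [mul_zero, sub_zero] at h1
      refine h1.congr' ?_
      filter_upwards [(isCompact_singleton (x := (0 : ℂ))).compl_mem_cocompact] with z hz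
      have : z ≠ 0 := by simpa using hz
      field_simp
    simpa using h2.zpow₀ (-n b) (Or.inl one_ne_zero)
  have hall := hlim.mul (tendsto_finsetProd Z fun b _ => hfac b)
  rw [Finset.prod_const_one, mul_one] at hall
  refine hall.congr' ?_
  filter_upwards [heq, (isCompact_singleton (x := (0 : ℂ))).compl_mem_cocompact] with z hz h0
  have h0 : z ≠ 0 := by simpa using h0
  rw [hz]
  simp only [div_zpow, Finset.prod_div_distrib]
  have : ∀ S : Finset ℂ, ∏ b ∈ S, z ^ (-n b) = z ^ (-∑ b ∈ S, n b) := by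
    intro S
    induction S using Finset.cons_induction with
    | empty => simp
    | cons b S hb ih => rw [Finset.prod_cons, Finset.sum_cons, ih, neg_add, zpow_add₀ h0]
  rw [this Z, zpow_sub₀ h0, zpow_neg]
  have h1 := zpow_ne_zero k h0
  have h2 := zpow_ne_zero (∑ b ∈ Z, n b) h0
  field_simp

end LineCongruence

namespace LineCongruence

/-! ### Oriented orthonormal frames of space -/

theorem inner_coord (u v : E3) : inner ℝ u v = u 0 * v 0 + u 1 * v 1 + u 2 * v 2 := by
  simp [PiLp.inner_apply, Fin.sum_univ_three, mul_comm]

theorem cross_coord (u v : E3) : cross u v =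
    !₂[u 1 * v 2 - u 2 * v 1, u 2 * v 0 - u 0 * v 2, u 0 * v 1 - u 1 * v 0] := by
  simp [cross, cross_apply]

theorem inner_cross_self_left (u v : E3) : inner ℝ (cross u v) u = (0 : ℝ) := by
  simp [inner_coord, cross_coord]; ring

theorem inner_cross_comm (u v x : E3) : inner ℝ (cross u v) x = (-inner ℝ v (cross u x) : ℝ) := by
  simp [inner_coord, cross_coord]; ring

theorem cross_add (u v x : E3) : cross u (v + x) = cross u v + cross u x := by
  ext i; fin_cases i <;> simp [cross_coord] <;> ring

theorem cross_smul (u v : E3) (c : ℝ) : cross u (c • v) = c • cross u v := by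
  ext i; fin_cases i <;> simp [cross_coord] <;> ring

theorem add_cross (u v x : E3) : cross (u + v) x = cross u x + cross v x := by
  ext i; fin_cases i <;> simp [cross_coord] <;> ring

theorem smul_cross (u v : E3) (c : ℝ) : cross (c • u) v = c • cross u v := by
  ext i; fin_cases i <;> simp [cross_coord] <;> ring

theorem cross_self_eq (u : E3) : cross u u = 0 := by
  ext i; fin_cases i <;> simp [cross_coord] <;> ring

theorem cross_swap (u v : E3) : cross v u = -cross u v := by
  ext i; fin_cases i <;> simp [cross_coord] <;> ring

theorem cross_cross_self (u v : E3) :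
    cross u (cross u v) = (inner ℝ u v : ℝ) • u - (inner ℝ u u : ℝ) • v := by
  rw [inner_coord, inner_coord]
  ext i; fin_cases i <;> simp [cross_coord] <;> ring

theorem inner_cross_cross (u v : E3) : inner ℝ (cross u v) (cross u v) =
    (inner ℝ u u * inner ℝ v v - inner ℝ u v ^ 2 : ℝ) := by
  simp only [cross_coord, inner_coord]; simp; ring

@[fun_prop]
theorem continuous_cross {X : Type*} [TopologicalSpace X] {f g : X → E3} (hf : Continuous f)
    (hg : Continuous g) : Continuous fun x => cross (f x) (g x) := by
  simp only [cross_coord]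
  refine (PiLp.continuous_toLp 2 _).comp (continuous_pi fun i => ?_)
  fin_cases i <;> simp <;> fun_prop

theorem norm_eq_one_of_inner {x : E3} (h : inner ℝ x x = (1 : ℝ)) : ‖x‖ = 1 := by
  rw [real_inner_self_eq_norm_sq] at h
  nlinarith [norm_nonneg x]

/-- `(w, a, b)` is a positively oriented orthonormal basis of `ℝ³`. -/
structure OrientedFrame (w a b : E3) : Prop where
  norm_fst : inner ℝ w w = (1 : ℝ)
  norm_snd : inner ℝ a a = (1 : ℝ)
  orthogonal : inner ℝ w a = (0 : ℝ)
  cross_eq : cross w a = b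

namespace OrientedFrame

variable {w a b : E3}

theorem of_orthonormal (h : Orthonormal ℝ ![w, a, b]) (hc : cross w a = b) :
    OrientedFrame w a b := by
  refine ⟨?_, ?_, ?_, hc⟩
  · have := h.1 0; simp at this; simp [this]
  · have := h.1 1; simp at this; simp [this]
  · have := h.2 (i := 0) (j := 1) (by decide); simpa using this

theorem inner_fst_thd (h : OrientedFrame w a b) : inner ℝ w b = (0 : ℝ) := by
  rw [← h.cross_eq, real_inner_comm, inner_cross_self_left]

theorem inner_snd_thd (h : OrientedFrame w a b) : inner ℝ a b = (0 : ℝ) := by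
  rw [← h.cross_eq, real_inner_comm, inner_cross_comm, cross_swap, inner_neg_right]
  simp [inner_coord, cross_coord]; ring

theorem norm_thd (h : OrientedFrame w a b) : inner ℝ b b = (1 : ℝ) := by
  rw [← h.cross_eq, inner_cross_cross, h.norm_fst, h.norm_snd, h.orthogonal]; norm_num

theorem orthonormal (h : OrientedFrame w a b) : Orthonormal ℝ ![w, a, b] := by
  have n1 : ‖w‖ = 1 := norm_eq_one_of_inner h.norm_fst
  have n2 : ‖a‖ = 1 := norm_eq_one_of_inner h.norm_snd
  have n3 : ‖b‖ = 1 := norm_eq_one_of_inner h.norm_thd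
  have h1 := h.orthogonal
  have h2 := h.inner_fst_thd
  have h3 := h.inner_snd_thd
  refine ⟨fun i => by fin_cases i <;> simpa, fun i j hij => ?_⟩
  fin_cases i <;> fin_cases j <;> simp_all [real_inner_comm]

theorem cross_thd (h : OrientedFrame w a b) : cross w b = -a := by
  rw [← h.cross_eq, cross_cross_self, h.norm_fst, h.orthogonal]; simp

theorem eq_sum (h : OrientedFrame w a b) (x : E3) :
    x = (inner ℝ x w : ℝ) • w + (inner ℝ x a : ℝ) • a + (inner ℝ x b : ℝ) • b := by
  have hcard : Fintype.card (Fin 3) = Module.finrank ℝ E3 := by simp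
  let B := basisOfOrthonormalOfCardEqFinrank h.orthonormal hcard
  have hB : ⇑B = ![w, a, b] := coe_basisOfOrthonormalOfCardEqFinrank ..
  let O := B.toOrthonormalBasis (by rw [hB]; exact h.orthonormal)
  have hO : ⇑O = ![w, a, b] := by simp [O, hB]
  have := (O.sum_repr' x).symm
  rw [hO, Fin.sum_univ_three] at this
  simpa [real_inner_comm] using this

theorem ext (h : OrientedFrame w a b) {x y : E3} (hw : inner ℝ x w = (inner ℝ y w : ℝ))
    (ha : inner ℝ x a = (inner ℝ y a : ℝ)) (hb : inner ℝ x b = (inner ℝ y b : ℝ)) : x = y := by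
  rw [h.eq_sum x, h.eq_sum y, hw, ha, hb]

end OrientedFrame

theorem IsTangentFrame.orientedFrame {w₀ : S2} {a b : S2 → E3} (h : IsTangentFrame w₀ a b) :
    ∀ᶠ w : S2 in 𝓝 w₀, OrientedFrame (w : E3) (a w) (b w) := by
  filter_upwards [h.orthonormal, h.oriented] with w h1 h2
  exact .of_orthonormal h1 h2

theorem inner_self_sphere (w : S2) : inner ℝ (w : E3) (w : E3) = (1 : ℝ) := by simp

theorem sphere_ne_zero (w : S2) : (w : E3) ≠ 0 := ne_zero_of_mem_unit_sphere w

theorem exists_orientedFrame (w : S2) : ∃ a b : E3, OrientedFrame (w : E3) a b := by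
  obtain ⟨x, hx0, hx⟩ : ∃ x : E3, x ≠ 0 ∧ inner ℝ (w : E3) x = (0 : ℝ) := by
    have : 1 < Module.finrank ℝ E3 := by simp
    obtain ⟨x, hx, hne⟩ := Submodule.exists_mem_ne_zero_of_ne_bot (p := (ℝ ∙ (w : E3))ᗮ) (by
      intro hbot
      have h1 := Submodule.finrank_orthogonal_span_singleton (𝕜 := ℝ) (n := 2)
        (sphere_ne_zero w)
      rw [hbot] at h1
      simp at h1)
    exact ⟨x, hne, Submodule.mem_orthogonal_singleton_iff_inner_right.1 hx⟩
  refine ⟨‖x‖⁻¹ • x, _, by simp, ?_, by simp [inner_smul_right, hx], rfl⟩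
  rw [real_inner_self_eq_norm_sq, norm_smul]
  simp [hx0]

/-! ### Radial projection and the differential of a section -/

theorem coe_normalize {x : E3} (hx : x ≠ 0) : (normalize x : E3) = ‖x‖⁻¹ • x := by
  simp [normalize, hx]

theorem normalize_coe (w : S2) : normalize (w : E3) = w := by
  ext1; rw [coe_normalize (sphere_ne_zero w)]; simp

theorem normalize_smul {x : E3} (hx : x ≠ 0) {c : ℝ} (hc : 0 < c) :
    normalize (c • x) = normalize x := by
  ext1
  rw [coe_normalize hx, coe_normalize (smul_ne_zero hc.ne' hx), norm_smul, smul_smul,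
    Real.norm_of_nonneg hc.le]
  congr 1; field_simp

theorem contMDiffAt_normalize {x : E3} (hx : x ≠ 0) :
    ContMDiffAt 𝓘(ℝ, E3) (𝓡 2) 2 normalize x := by
  let U : TopologicalSpace.Opens E3 := ⟨{0}ᶜ, isOpen_compl_singleton⟩
  have h1 : ContMDiff 𝓘(ℝ, E3) 𝓘(ℝ, E3) 2 (fun y : U => ‖(y : E3)‖⁻¹ • (y : E3)) := by
    intro y
    refine (contMDiffAt_subtype_iff (U := U) (f := fun y : E3 => ‖y‖⁻¹ • y)).2 ?_
    have hy : (y : E3) ≠ 0 := y.2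
    exact (((contDiffAt_norm ℝ hy).inv (norm_ne_zero_iff.2 hy)).smul contDiffAt_id).contMDiffAt
  have h2 := h1.codRestrict_sphere (n := 2) (fun y => by
    have hy : (y : E3) ≠ 0 := y.2
    simp [norm_smul, hy])
  refine (contMDiffAt_subtype_iff (U := U) (f := normalize) (x := ⟨x, hx⟩)).1 ?_
  refine (h2 ⟨x, hx⟩).congr_of_eventuallyEq (.of_forall fun y => ?_)
  ext1
  exact coe_normalize y.2

theorem continuousAt_normalize {x : E3} (hx : x ≠ 0) : ContinuousAt normalize x :=
  (contMDiffAt_normalize hx).continuousAt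

namespace GlobalSection

variable (V : GlobalSection)

theorem contDiffAt_extension {x : E3} (hx : x ≠ 0) :
    ContDiffAt ℝ 2 (fun y : E3 => V.toFun (normalize y)) x :=
  (ContMDiffAt.comp x (V.contMDiff _) (contMDiffAt_normalize hx)).contDiffAt

/-- The differential of the section at `w`, as a linear map on `ℝ³` that vanishes on `w`. -/
noncomputable def D (w : S2) : E3 →L[ℝ] E3 :=
  fderiv ℝ (fun y : E3 => V.toFun (normalize y)) (w : E3)

theorem differential_eq (w : S2) (x : E3) : V.differential w x = V.D w x := rfl

theorem hasFDerivAt_extension (w : S2) :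
    HasFDerivAt (fun y : E3 => V.toFun (normalize y)) (V.D w) (w : E3) :=
  ((V.contDiffAt_extension (sphere_ne_zero w)).differentiableAt (by norm_num)).hasFDerivAt

theorem continuous_D : Continuous V.D := by
  rw [continuous_iff_continuousAt]
  intro w
  exact ContinuousAt.comp (f := fun w : S2 => (w : E3))
    ((V.contDiffAt_extension (sphere_ne_zero w)).fderiv_right (m := 1) (by norm_num)).continuousAt
    continuous_subtype_val.continuousAt

theorem D_self (w : S2) : V.D w w = 0 := by
  have h1 : HasDerivAt (fun t : ℝ => (1 + t) • (w : E3)) (w : E3) 0 := by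
    simpa using ((hasDerivAt_id (0 : ℝ)).const_add 1).smul_const (w : E3)
  have h2 := (V.hasFDerivAt_extension w)
  have h3 : HasDerivAt (fun t : ℝ => V.toFun (normalize ((1 + t) • (w : E3)))) (V.D w w) 0 := by
    refine HasFDerivAt.comp_hasDerivAt (0 : ℝ) (l := fun y : E3 => V.toFun (normalize y))
      (f := fun t : ℝ => (1 + t) • (w : E3)) (?_ : HasFDerivAt _ (V.D w) _) h1
    simpa using h2
  have h4 : HasDerivAt (fun t : ℝ => V.toFun (normalize ((1 + t) • (w : E3)))) 0 0 := by
    refine (hasDerivAt_const (0 : ℝ) (V.toFun w)).congr_of_eventuallyEq ?_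
    filter_upwards [lt_mem_nhds (show (-1 : ℝ) < 0 by norm_num)] with t ht
    rw [normalize_smul (sphere_ne_zero w) (by linarith), normalize_coe]
  exact h3.unique h4

/-- Differentiating `⟨V, w⟩ = 0`. -/
theorem inner_D_self (w : S2) (x : E3) :
    inner ℝ (V.D w x) (w : E3) = (-inner ℝ (V.toFun w) x : ℝ) := by
  have h1 := (V.hasFDerivAt_extension w).inner ℝ (hasFDerivAt_id (w : E3))
  have h2 : HasFDerivAt (fun y : E3 => inner ℝ (V.toFun (normalize y)) (id y))
      (0 : E3 →L[ℝ] ℝ) (w : E3) := by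
    refine (hasFDerivAt_const (0 : ℝ) (w : E3)).congr_of_eventuallyEq ?_
    filter_upwards [isOpen_ne.mem_nhds (sphere_ne_zero w)] with y hy
    have h3 := V.tangent (normalize y)
    rw [coe_normalize hy, inner_smul_right] at h3
    exact (mul_eq_zero.1 h3).resolve_left (inv_ne_zero (norm_ne_zero_iff.2 hy))
  have h3 := congrArg (fun f => f x) (h1.unique h2)
  simp [normalize_coe] at h3
  linarith

/-! ### Complex points -/

/-- Preservation of the tangent plane by the complex structure, as an equation for the
differential of the section that makes sense for all vectors of `ℝ³`. -/
theorem isComplexPoint_iff (w : S2) : V.IsComplexPoint w ↔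
    ∀ x : E3, V.D w (cross w x) =
      cross w (V.D w x) - (inner ℝ (V.toFun w) (cross w x) : ℝ) • (w : E3) := by
  constructor
  · intro h x
    -- Both sides depend only on the component of `x` tangent to the sphere.
    set y : E3 := x - (inner ℝ x (w : E3) : ℝ) • (w : E3) with hy
    have hyw : inner ℝ y (w : E3) = (0 : ℝ) := by
      rw [hy, inner_sub_left, inner_smul_left, inner_self_sphere]; simp
    have hDy : V.D w y = V.D w x := by simp [hy, D_self]
    have hcy : cross w y = cross w x := by
      have hx : x = y + (inner ℝ x (w : E3) : ℝ) • (w : E3) := by rw [hy]; abel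
      rw [hx, cross_add, cross_smul, cross_self_eq]; simp
    obtain ⟨z, -, hz⟩ := h (V.differential w y, y) ⟨y, hyw, rfl⟩
    have h1 := congrArg Prod.fst hz
    have h2 := congrArg Prod.snd hz
    simp only [complexStructure] at h1 h2
    rw [← h2] at h1
    simp only [differential_eq] at h1
    rw [hDy] at h1
    have hdir : (((V.line w).direction : S2) : E3) = w := rfl
    have hdis : (V.line w).displacement = V.toFun w := rfl
    rw [hdir, hdis, hcy] at h1
    exact h1.symm
  · rintro h v ⟨x, hx, rfl⟩
    refine ⟨cross w x, inner_cross_self_left _ _, ?_⟩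
    refine Prod.ext ?_ rfl
    exact (h x).symm

theorem isClosed_isComplexPoint : IsClosed {w | V.IsComplexPoint w} := by
  simp only [isComplexPoint_iff, Set.ofPred_forall]
  refine isClosed_iInter fun x => isClosed_eq ?_ ?_
  · exact V.continuous_D.clm_apply (by fun_prop)
  · have h1 : Continuous fun w : S2 => V.D w x := V.continuous_D.clm_apply continuous_const
    have h2 : Continuous V.toFun := V.contMDiff.continuous
    fun_prop

/-- In an oriented orthonormal frame, `δ⁺f ∧ δ⁻f` is the trace-free symmetric part of the
differential of the section. -/
theorem complexDefect_eq (w : S2) {a b : E3} (h : OrientedFrame (w : E3) a b) :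
    V.complexDefect w a b =
      (((inner ℝ (V.D w a) a - inner ℝ (V.D w b) b : ℝ) : ℂ) +
        ((inner ℝ (V.D w a) b + inner ℝ (V.D w b) a : ℝ) : ℂ) * Complex.I) / 2 := by
  have h1 : (inner ℝ b a : ℝ) = 0 := by rw [real_inner_comm]; exact h.inner_snd_thd
  simp only [complexDefect, differential_eq, h.norm_snd, h.norm_thd, h.inner_snd_thd, h1]
  push_cast
  linear_combination (-(1 / 2 : ℂ) * (inner ℝ (V.D w a) a : ℝ) + (1 / 2) * (inner ℝ (V.D w b) b : ℝ)
    - (1 / 2) * (inner ℝ (V.D w a) b : ℝ) * Complex.I) * Complex.I_sq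

theorem complexDefect_eq_zero_iff (w : S2) {a b : E3} (h : OrientedFrame (w : E3) a b) :
    V.complexDefect w a b = 0 ↔ inner ℝ (V.D w a) a = (inner ℝ (V.D w b) b : ℝ) ∧
      inner ℝ (V.D w a) b + inner ℝ (V.D w b) a = (0 : ℝ) := by
  rw [V.complexDefect_eq w h, div_eq_zero_iff, or_iff_left two_ne_zero, Complex.ext_iff]
  simp [sub_eq_zero]

theorem isComplexPoint_iff_complexDefect (w : S2) {a b : E3} (h : OrientedFrame (w : E3) a b) :
    V.IsComplexPoint w ↔ V.complexDefect w a b = 0 := by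
  rw [V.complexDefect_eq_zero_iff w h, V.isComplexPoint_iff]
  have ha : ∀ y : E3, inner ℝ (cross w y) a = (-inner ℝ y b : ℝ) := fun y => by
    rw [inner_cross_comm, h.cross_eq]
  have hb : ∀ y : E3, inner ℝ (cross w y) b = (inner ℝ y a : ℝ) := fun y => by
    rw [inner_cross_comm, h.cross_thd, inner_neg_right, neg_neg]
  have hwa := h.orthogonal
  have hwb := h.inner_fst_thd
  constructor
  · intro H
    have h1 := H a
    rw [h.cross_eq] at h1
    have h2 := congrArg (fun v => (inner ℝ v a : ℝ)) h1
    have h3 := congrArg (fun v => (inner ℝ v b : ℝ)) h1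
    simp only [inner_sub_left, ha, hb, inner_smul_left, hwa, hwb] at h2 h3
    simp at h2 h3
    exact ⟨h3.symm, by linarith⟩
  · rintro ⟨h1, h2⟩ x
    have hx := h.eq_sum x
    have hca : cross w x = (inner ℝ x a : ℝ) • b - (inner ℝ x b : ℝ) • a := by
      conv_lhs => rw [hx]
      rw [cross_add, cross_add, cross_smul, cross_smul, cross_smul, cross_self_eq, h.cross_eq,
        h.cross_thd]
      simp [sub_eq_add_neg]
    have hDx : V.D w x = (inner ℝ x a : ℝ) • V.D w a + (inner ℝ x b : ℝ) • V.D w b := by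
      conv_lhs => rw [hx]
      simp [D_self]
    refine h.ext ?_ ?_ ?_
    · rw [inner_D_self, inner_sub_left, inner_cross_self_left, inner_smul_left, inner_self_sphere]
      simp
    · rw [inner_sub_left, ha, inner_smul_left, hwa, hca, hDx]
      simp only [map_sub, map_smul, inner_sub_left, inner_add_left, inner_smul_left]
      simp
      linear_combination (inner ℝ x a : ℝ) * h2 - (inner ℝ x b : ℝ) * h1
    · rw [inner_sub_left, hb, inner_smul_left, hwb, hca, hDx]
      simp only [map_sub, map_smul, inner_sub_left, inner_add_left, inner_smul_left]
      simp
      linear_combination -(inner ℝ x a : ℝ) * h1 - (inner ℝ x b : ℝ) * h2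

/-- Rotating the frame by an angle `α` multiplies `δ⁺f ∧ δ⁻f` by `exp (-2iα)`. -/
theorem complexDefect_change (w : S2) {a b a' b' : E3} (h : OrientedFrame (w : E3) a b)
    (h' : OrientedFrame (w : E3) a' b') : V.complexDefect w a' b' =
      (((inner ℝ a' a : ℝ) : ℂ) - (inner ℝ a' b : ℝ) * Complex.I) ^ 2 * V.complexDefect w a b := by
  set p : ℝ := inner ℝ a' a
  set q : ℝ := inner ℝ a' b
  have ha' : a' = p • a + q • b := by
    have := h.eq_sum a'
    rwa [real_inner_comm, h'.orthogonal, zero_smul, zero_add] at this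
  have hb' : b' = p • b - q • a := by
    rw [← h'.cross_eq, ha', cross_add, cross_smul, cross_smul, h.cross_eq, h.cross_thd]
    simp [sub_eq_add_neg]
  rw [V.complexDefect_eq w h, V.complexDefect_eq w h', ha', hb']
  simp only [map_sub, map_add, map_smul, inner_sub_left, inner_add_left, inner_smul_left,
    inner_sub_right, inner_add_right, inner_smul_right]
  apply Complex.ext
  · simp [pow_two]; ring
  · simp [pow_two]; ring

end GlobalSection

end LineCongruence

namespace LineCongruence

/-! ### Shear and complex points -/

theorem inner_inv_norm_smul_self {x : E3} (hx : x ≠ 0) :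
    inner ℝ (‖x‖⁻¹ • x) (‖x‖⁻¹ • x) = (1 : ℝ) := by
  rw [real_inner_self_eq_norm_sq, norm_smul]; simp [hx]

theorem contDiffAt_cross {f g : E3 → E3} {p : E3} {n : ℕ∞ω} (hf : ContDiffAt ℝ n f p)
    (hg : ContDiffAt ℝ n g p) : ContDiffAt ℝ n (fun q => cross (f q) (g q)) p := by
  have hf' := contDiffAt_euclidean.1 hf
  have hg' := contDiffAt_euclidean.1 hg
  refine contDiffAt_euclidean.2 fun i => ?_
  simp only [cross_coord]
  fin_cases i
  · simpa using ((hf' 1).mul (hg' 2)).sub ((hf' 2).mul (hg' 1))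
  · simpa using ((hf' 2).mul (hg' 0)).sub ((hf' 0).mul (hg' 2))
  · simpa using ((hf' 0).mul (hg' 1)).sub ((hf' 1).mul (hg' 0))

/-- Differentiating a constant inner product of two vector fields. -/
theorem inner_fderiv_add_of_eventually_const {f g : E3 → E3} {p : E3} {c : ℝ}
    (hf : DifferentiableAt ℝ f p) (hg : DifferentiableAt ℝ g p)
    (h : ∀ᶠ q in 𝓝 p, inner ℝ (f q) (g q) = c) (x : E3) :
    inner ℝ (fderiv ℝ f p x) (g p) + inner ℝ (fderiv ℝ g p x) (f p) = (0 : ℝ) := by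
  have h1 := hf.hasFDerivAt.inner ℝ hg.hasFDerivAt
  have h2 := (hasFDerivAt_const (𝕜 := ℝ) c p).congr_of_eventuallyEq h
  have h3 := congrArg (fun L => L x) (h1.unique h2)
  simp [real_inner_comm] at h3
  rw [real_inner_comm (g p), real_inner_comm (f p)]
  linarith

namespace IsCongruenceFrame

variable {C : Set OrientedLine} {γ : OrientedLine} {p : E3} {e₀ e₁ e₂ : E3 → E3}

theorem orientedFrame (h : IsCongruenceFrame C γ p e₀ e₁ e₂) :
    ∀ᶠ q in 𝓝 p, OrientedFrame (e₀ q) (e₁ q) (e₂ q) := by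
  filter_upwards [h.orthonormal, h.oriented] with q h1 h2
  exact .of_orthonormal h1 h2

/-- Only the derivative of `e₀` contributes to the shear, because the frame is orthonormal. -/
theorem shear_eq_zero_iff (h : IsCongruenceFrame C γ p e₀ e₁ e₂) :
    shear e₀ e₁ e₂ p = 0 ↔
      inner ℝ (fderiv ℝ e₀ p (e₁ p)) (e₁ p) = (inner ℝ (fderiv ℝ e₀ p (e₂ p)) (e₂ p) : ℝ) ∧
      inner ℝ (fderiv ℝ e₀ p (e₁ p)) (e₂ p) + inner ℝ (fderiv ℝ e₀ p (e₂ p)) (e₁ p) =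
        (0 : ℝ) := by
  have d1 := h.contDiff₁.differentiableAt one_ne_zero
  have d2 := h.contDiff₂.differentiableAt one_ne_zero
  have h11 := inner_fderiv_add_of_eventually_const d1 d1
    (h.orientedFrame.mono fun q hq => hq.norm_snd) (e₀ p)
  have h22 := inner_fderiv_add_of_eventually_const d2 d2
    (h.orientedFrame.mono fun q hq => hq.norm_thd) (e₀ p)
  have h12 := inner_fderiv_add_of_eventually_const d1 d2
    (h.orientedFrame.mono fun q hq => hq.inner_snd_thd) (e₀ p)
  simp only [shear, VectorField.lieBracket, inner_sub_left]
  rw [div_eq_zero_iff, or_iff_left two_ne_zero, Complex.ext_iff]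
  simp
  constructor
  · rintro ⟨h1, h2⟩
    constructor <;> linarith
  · rintro ⟨h1, h2⟩
    constructor <;> linarith

end IsCongruenceFrame

namespace GlobalSection

variable (V : GlobalSection)

/-- Differentiating `V (e₀ q) = q - ⟨q, e₀ q⟩ e₀ q`, which says that the line of the congruence
with direction `e₀ q` passes through `q`. -/
theorem D_fderiv_direction {w : S2} {p : E3} {e₀ e₁ e₂ : E3 → E3}
    (h : IsCongruenceFrame V.graph (V.line w) p e₀ e₁ e₂) (x : E3) :
    ∃ c : ℝ, V.D w (fderiv ℝ e₀ p x) =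
      x - c • (w : E3) - (inner ℝ p (w : E3) : ℝ) • fderiv ℝ e₀ p x := by
  have hb : e₀ p = (w : E3) := h.base
  have d0 := (h.contDiff₀.differentiableAt one_ne_zero).hasFDerivAt
  have h1 : HasFDerivAt (fun q => V.toFun (normalize (e₀ q))) (V.D w ∘L fderiv ℝ e₀ p) p := by
    refine HasFDerivAt.comp p (g := fun y : E3 => V.toFun (normalize y)) ?_ d0
    rw [hb]; exact V.hasFDerivAt_extension w
  have h2 := (hasFDerivAt_id p).sub (((hasFDerivAt_id p).inner ℝ d0).smul d0)
  have h3 : (fun q => V.toFun (normalize (e₀ q))) =ᶠ[𝓝 p]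
      (id - fun q => (inner ℝ (id q) (e₀ q) : ℝ) • e₀ q) := by
    filter_upwards [h.tangent] with q hq
    obtain ⟨-, ⟨w', rfl⟩, ⟨r, hr⟩, hdir⟩ := hq
    have hdir' : e₀ q = (w' : E3) := hdir
    have hr' : q = V.toFun w' + r • (w' : E3) := hr
    have hin : inner ℝ q (w' : E3) = r := by
      rw [hr', inner_add_left, V.tangent, inner_smul_left, inner_self_sphere]; simp
    simp only [Pi.sub_apply, id, hdir', normalize_coe, hin]
    exact eq_sub_of_add_eq hr'.symm
  have h4 := congrArg (fun L => L x) (h1.unique (h2.congr_of_eventuallyEq h3))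
  simp [hb] at h4
  refine ⟨inner ℝ p (fderiv ℝ e₀ p x) + inner ℝ x (w : E3), h4.trans ?_⟩
  rw [sub_sub, add_comm]

/-- Along a line of the congruence, the shear vanishes at a point where it is defined if and only if
the line is a complex point. In an oriented orthonormal frame at the point with position `r` on
the line, the derivative of the direction field is the inverse of `A + r`, with `A` the tangential
part of the differential of the section; a `2 × 2` matrix and its inverse are simultaneously
conformal. -/
theorem shear_eq_zero_iff_isComplexPoint {w : S2} {p : E3} {e₀ e₁ e₂ : E3 → E3}
    (h : IsCongruenceFrame V.graph (V.line w) p e₀ e₁ e₂) :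
    shear e₀ e₁ e₂ p = 0 ↔ V.IsComplexPoint w := by
  have hb : e₀ p = (w : E3) := h.base
  have hf : OrientedFrame (w : E3) (e₁ p) (e₂ p) := hb ▸ h.orientedFrame.self_of_nhds
  rw [h.shear_eq_zero_iff, V.isComplexPoint_iff_complexDefect w hf,
    V.complexDefect_eq_zero_iff w hf]
  set a := e₁ p
  set b := e₂ p
  set P := fderiv ℝ e₀ p
  have d0 := h.contDiff₀.differentiableAt one_ne_zero
  have hPw : ∀ x, inner ℝ (P x) (w : E3) = (0 : ℝ) := fun x => by
    have := inner_fderiv_add_of_eventually_const d0 d0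
      (h.orientedFrame.mono fun q hq => hq.norm_fst) x
    rw [hb] at this
    linarith
  have hexp : ∀ x, V.D w (P x) =
      (inner ℝ (P x) a : ℝ) • V.D w a + (inner ℝ (P x) b : ℝ) • V.D w b := fun x => by
    conv_lhs => rw [hf.eq_sum (P x), hPw]
    simp
  have hwa := hf.orthogonal
  have hwb := hf.inner_fst_thd
  have hba : inner ℝ b a = (0 : ℝ) := by rw [real_inner_comm]; exact hf.inner_snd_thd
  obtain ⟨ca, hca⟩ := V.D_fderiv_direction h a
  obtain ⟨cb, hcb⟩ := V.D_fderiv_direction h b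
  change V.D w (P a) = _ at hca
  change V.D w (P b) = _ at hcb
  rw [hexp] at hca hcb
  have e11 := congrArg (fun v => (inner ℝ v a : ℝ)) hca
  have e12 := congrArg (fun v => (inner ℝ v b : ℝ)) hca
  have e21 := congrArg (fun v => (inner ℝ v a : ℝ)) hcb
  have e22 := congrArg (fun v => (inner ℝ v b : ℝ)) hcb
  simp only [inner_add_left, inner_sub_left, inner_smul_left, hwa, hwb, hf.norm_snd, hf.norm_thd,
    hf.inner_snd_thd, hba, RCLike.conj_to_real, mul_zero, sub_zero, zero_sub] at e11 e12 e21 e22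
  change _ = _ - _ * inner ℝ (P a) a at e11
  change _ = -(_ * inner ℝ (P a) b) at e12
  change _ = -(_ * inner ℝ (P b) a) at e21
  change _ = _ - _ * inner ℝ (P b) b at e22
  generalize (inner ℝ p (w : E3) : ℝ) = r at *
  generalize (inner ℝ (P a) a : ℝ) = p₁ at *
  generalize (inner ℝ (P a) b : ℝ) = p₂ at *
  generalize (inner ℝ (P b) a : ℝ) = p₃ at *
  generalize (inner ℝ (P b) b : ℝ) = p₄ at *
  generalize (inner ℝ (V.D w a) a : ℝ) = m₁ at *
  generalize (inner ℝ (V.D w a) b : ℝ) = m₂ at *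
  generalize (inner ℝ (V.D w b) a : ℝ) = m₃ at *
  generalize (inner ℝ (V.D w b) b : ℝ) = m₄ at *
  -- With `p` the matrix of `P` and `m` that of `D`, the four equations say `p (m + r) = 1`.
  have hdet : (p₁ * p₄ - p₂ * p₃) * ((m₁ + r) * (m₄ + r) - m₂ * m₃) = 1 := by
    have f1 : p₁ * (m₁ + r) + p₂ * m₃ = 1 := by linarith
    have f2 : p₁ * m₂ + p₂ * (m₄ + r) = 0 := by linarith
    have f3 : p₃ * (m₁ + r) + p₄ * m₃ = 0 := by linarith
    have f4 : p₃ * m₂ + p₄ * (m₄ + r) = 1 := by linarith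
    linear_combination (p₃ * m₂ + p₄ * (m₄ + r)) * f1 + f4 - (p₃ * (m₁ + r) + p₄ * m₃) * f2
  have hne : p₁ * p₄ - p₂ * p₃ ≠ 0 := left_ne_zero_of_mul_eq_one hdet
  have k1 : (p₁ * p₄ - p₂ * p₃) * (m₁ - m₄) = p₄ - p₁ := by
    linear_combination p₄ * e11 - p₂ * e21 - p₁ * e22 + p₃ * e12
  have k2 : (p₁ * p₄ - p₂ * p₃) * (m₂ + m₃) = -(p₂ + p₃) := by
    linear_combination p₄ * e12 - p₂ * e22 + p₁ * e21 - p₃ * e11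
  constructor
  · rintro ⟨h1, h2⟩
    exact ⟨sub_eq_zero.1 ((mul_eq_zero.1 (k1.trans (by linarith))).resolve_left hne),
      (mul_eq_zero.1 (k2.trans (by linarith))).resolve_left hne⟩
  · rintro ⟨h1, h2⟩
    rw [h1, sub_self, mul_zero] at k1
    rw [h2, mul_zero] at k2
    constructor <;> linarith

/-- Far enough along each line of the congruence there is a congruence frame: there the
lines near the given one fill a neighbourhood of the point simply. -/
theorem exists_isCongruenceFrame (w : S2) : ∃ p ∈ (V.line w).points, ∃ e₀ e₁ e₂ : E3 → E3,
    IsCongruenceFrame V.graph (V.line w) p e₀ e₁ e₂ := by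
  -- For `ρ` larger than the norm of the differential `D`, the map `D + ρ` is injective.
  set ρ : ℝ := ‖V.D w‖ + 1 with hρ
  have hρ0 : 0 < ρ := by positivity
  let T : E3 →L[ℝ] E3 := V.D w + ρ • ContinuousLinearMap.id ℝ E3
  have hinj : Function.Injective (T : E3 →ₗ[ℝ] E3) := by
    rw [← LinearMap.ker_eq_bot, LinearMap.ker_eq_bot']
    intro x hx
    have h1 : V.D w x = -(ρ • x) := eq_neg_of_add_eq_zero_left hx
    have h2 := (V.D w).le_opNorm x
    rw [h1, norm_neg, norm_smul, Real.norm_of_nonneg hρ0.le, hρ] at h2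
    exact norm_le_zero_iff.1 (by linarith)
  let T' : E3 ≃L[ℝ] E3 :=
    (LinearEquiv.ofInjectiveEndo (T : E3 →ₗ[ℝ] E3) hinj).toContinuousLinearEquiv
  have hT' : (T' : E3 →L[ℝ] E3) = T := by ext x; rfl
  -- `Φ y` lies on the line with direction `y / |y|`, so `Φ` is inverted to find that direction.
  set Φ : E3 → E3 := fun y => V.toFun (normalize y) + ρ • y with hΦ
  have hΦc : ContDiffAt ℝ 2 Φ w :=
    (V.contDiffAt_extension (sphere_ne_zero w)).add (contDiffAt_id.const_smul ρ)
  have hΦd : HasFDerivAt Φ (T' : E3 →L[ℝ] E3) w := by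
    rw [hT']
    exact (V.hasFDerivAt_extension w).add ((hasFDerivAt_id (w : E3)).const_smul ρ)
  set p : E3 := Φ w with hp
  set g : E3 → E3 := hΦc.localInverse hΦd two_ne_zero with hg
  have hgc : ContDiffAt ℝ 2 g p := hΦc.to_localInverse hΦd two_ne_zero
  have hgp : g p = w := hΦc.localInverse_apply_image hΦd two_ne_zero
  have hinv : ∀ᶠ q in 𝓝 p, Φ (g q) = q :=
    (hΦc.hasStrictFDerivAt' hΦd two_ne_zero).eventually_right_inverse
  have hg0 : ∀ᶠ q in 𝓝 p, g q ≠ 0 :=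
    hgc.continuousAt.eventually_ne (by rw [hgp]; exact sphere_ne_zero w)
  obtain ⟨a, b, hab⟩ := exists_orientedFrame w
  set e₀ : E3 → E3 := fun q => ‖g q‖⁻¹ • g q with he₀
  have he₀p : e₀ p = w := by simp [he₀, hgp]
  have hc₀ : ContDiffAt ℝ 2 e₀ p := by
    have hgp0 : g p ≠ 0 := by rw [hgp]; exact sphere_ne_zero w
    exact ((hgc.norm ℝ hgp0).inv (norm_ne_zero_iff.2 hgp0)).smul hgc
  -- The remaining vectors come from the Gram–Schmidt process and the vector product.
  set f : E3 → E3 := fun q => a - (inner ℝ a (e₀ q) : ℝ) • e₀ q with hf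
  have hfp : f p = a := by
    have := hab.orthogonal
    rw [real_inner_comm] at this
    simp [hf, he₀p, this]
  have hfc : ContDiffAt ℝ 2 f p := contDiffAt_const.sub ((contDiffAt_const.inner ℝ hc₀).smul hc₀)
  have hfp0 : f p ≠ 0 := by
    rw [hfp]; intro h0
    have := hab.norm_snd
    rw [h0] at this; simp at this
  have hf0 : ∀ᶠ q in 𝓝 p, f q ≠ 0 := hfc.continuousAt.eventually_ne hfp0
  set e₁ : E3 → E3 := fun q => ‖f q‖⁻¹ • f q with he₁
  have hc₁ : ContDiffAt ℝ 2 e₁ p := ((hfc.norm ℝ hfp0).inv (norm_ne_zero_iff.2 hfp0)).smul hfc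
  have hframe : ∀ᶠ q in 𝓝 p, OrientedFrame (e₀ q) (e₁ q) (cross (e₀ q) (e₁ q)) := by
    filter_upwards [hg0, hf0] with q h1 h2
    have hn : inner ℝ (e₀ q) (e₀ q) = (1 : ℝ) := by
      exact inner_inv_norm_smul_self h1
    refine ⟨hn, ?_, ?_, rfl⟩
    · exact inner_inv_norm_smul_self h2
    · have h3 : inner ℝ (e₀ q) (f q) = (0 : ℝ) := by
        rw [hf, inner_sub_right, inner_smul_right, hn, real_inner_comm]; ring
      rw [he₁, inner_smul_right, h3, mul_zero]
  refine ⟨p, ⟨ρ, by simp only [hp, hΦ, normalize_coe]; rfl⟩, e₀, e₁, fun q => cross (e₀ q) (e₁ q),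
    ⟨hc₀.of_le one_le_two, hc₁.of_le one_le_two,
      (contDiffAt_cross hc₀ hc₁).of_le one_le_two, hframe.mono fun q hq => hq.orthonormal,
      .of_forall fun q => rfl, ?_, he₀p⟩⟩
  filter_upwards [hinv, hg0] with q h1 h2
  refine ⟨_, ⟨normalize (g q), rfl⟩, ⟨ρ * ‖g q‖, ?_⟩, (coe_normalize h2).symm⟩
  have h3 : ((V.line (normalize (g q))).direction : E3) = ‖g q‖⁻¹ • g q := coe_normalize h2
  have h4 : (V.line (normalize (g q))).displacement = V.toFun (normalize (g q)) := rfl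
  rw [h3, h4, smul_smul, mul_assoc, mul_inv_cancel₀ (norm_ne_zero_iff.2 h2), mul_one]
  exact h1.symm

theorem line_injective : Function.Injective V.line := fun _ _ h =>
  congrArg OrientedLine.direction h

theorem line_mem_shearFreeLines_iff (w : S2) :
    V.line w ∈ shearFreeLines V.graph ↔ V.IsComplexPoint w := by
  constructor
  · rintro ⟨-, h⟩
    obtain ⟨p, hp, e₀, e₁, e₂, hfr⟩ := V.exists_isCongruenceFrame w
    exact (V.shear_eq_zero_iff_isComplexPoint hfr).1 (h p hp e₀ e₁ e₂ hfr)
  · intro h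
    exact ⟨⟨w, rfl⟩, fun p _ e₀ e₁ e₂ hfr => (V.shear_eq_zero_iff_isComplexPoint hfr).2 h⟩

theorem shearFreeLines_eq : shearFreeLines V.graph = V.line '' {w | V.IsComplexPoint w} := by
  ext γ
  constructor
  · intro h
    obtain ⟨w, rfl⟩ := h.1
    exact ⟨w, (V.line_mem_shearFreeLines_iff w).1 h, rfl⟩
  · rintro ⟨w, hw, rfl⟩
    exact (V.line_mem_shearFreeLines_iff w).2 hw

/-- A discrete set of shear-free lines is finite, because the complex points form a compact set. -/
theorem finite_isComplexPoint (h : DiscreteTopology (shearFreeLines V.graph)) :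
    {w | V.IsComplexPoint w}.Finite := by
  have hc : IsCompact (shearFreeLines V.graph) := by
    rw [V.shearFreeLines_eq]
    refine V.isClosed_isComplexPoint.isCompact.image ?_
    exact (V.contMDiff.continuous.prodMk continuous_subtype_val).subtype_mk _
  have hfin := hc.finite (isDiscrete_iff_discreteTopology.2 h)
  rw [V.shearFreeLines_eq] at hfin
  exact hfin.of_finite_image V.line_injective.injOn

end GlobalSection

end LineCongruence

namespace LineCongruence

open Complex Set Filter

/-! ### Stereographic coordinates -/

namespace OrientedFrame

variable {n u v : E3}

theorem inner_table (h : OrientedFrame n u v) :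
    (inner ℝ n n : ℝ) = 1 ∧ (inner ℝ u u : ℝ) = 1 ∧ (inner ℝ v v : ℝ) = 1 ∧
    (inner ℝ n u : ℝ) = 0 ∧ (inner ℝ u n : ℝ) = 0 ∧ (inner ℝ n v : ℝ) = 0 ∧
    (inner ℝ v n : ℝ) = 0 ∧ (inner ℝ u v : ℝ) = 0 ∧ (inner ℝ v u : ℝ) = 0 :=
  ⟨h.norm_fst, h.norm_snd, h.norm_thd, h.orthogonal, by rw [real_inner_comm, h.orthogonal],
    h.inner_fst_thd, by rw [real_inner_comm, h.inner_fst_thd], h.inner_snd_thd,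
    by rw [real_inner_comm, h.inner_snd_thd]⟩

theorem cross_snd_thd (h : OrientedFrame n u v) : cross u v = n := by
  have hun : inner ℝ u n = (0 : ℝ) := by rw [real_inner_comm, h.orthogonal]
  rw [← h.cross_eq, cross_swap u n, ← neg_one_smul ℝ, cross_smul, cross_cross_self, hun,
    h.norm_snd]
  simp

theorem neg (h : OrientedFrame n u v) : OrientedFrame (-n) u (-v) := by
  refine ⟨by rw [inner_neg_neg, h.norm_fst], h.norm_snd, ?_, ?_⟩
  · rw [inner_neg_left, h.orthogonal, neg_zero]
  · rw [← neg_one_smul ℝ n, smul_cross, h.cross_eq, neg_one_smul]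

end OrientedFrame

/-- A positive multiple of the point of the sphere with stereographic coordinate `ζ`, for the
projection from `-n` and the orthonormal basis `u, v` of the plane orthogonal to `n`. -/
noncomputable def stereoVector (n u v : E3) (ζ : ℂ) : E3 :=
  (2 * ζ.re) • u + (2 * ζ.im) • v + (1 - normSq ζ) • n

/-- The point of the sphere with stereographic coordinate `ζ`. -/
noncomputable def stereoPoint (n u v : E3) (ζ : ℂ) : S2 := normalize (stereoVector n u v ζ)

/-- The stereographic coordinate of a point of the sphere (`0` at the pole `-n`). -/
noncomputable def stereoCoord (n u v : E3) (w : S2) : ℂ :=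
  ((inner ℝ (w : E3) u : ℝ) + (inner ℝ (w : E3) v : ℝ) * I) / (1 + inner ℝ (w : E3) n : ℝ)

/-- The real part of the null vector `(1 - ζ²) u + i (1 + ζ²) v - 2 ζ n`, a positive multiple of
the derivative of the point of the sphere in the direction of the real axis. -/
noncomputable def stereoRe (n u v : E3) (ζ : ℂ) : E3 :=
  (1 - ζ.re ^ 2 + ζ.im ^ 2) • u + (-2 * ζ.re * ζ.im) • v + (-2 * ζ.re) • n

/-- The imaginary part of the null vector `(1 - ζ²) u + i (1 + ζ²) v - 2 ζ n`. -/
noncomputable def stereoIm (n u v : E3) (ζ : ℂ) : E3 :=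
  (-2 * ζ.re * ζ.im) • u + (1 + ζ.re ^ 2 - ζ.im ^ 2) • v + (-2 * ζ.im) • n

theorem one_add_normSq_pos (ζ : ℂ) : 0 < 1 + normSq ζ := by
  have := normSq_nonneg ζ; linarith

section Stereo

variable {n u v : E3} (h : OrientedFrame n u v)

include h

theorem norm_stereoVector (ζ : ℂ) : ‖stereoVector n u v ζ‖ = 1 + normSq ζ := by
  obtain ⟨nn, uu, vv, nu, un, nv, vn, uv, vu⟩ := h.inner_table
  have h1 : (inner ℝ (stereoVector n u v ζ) (stereoVector n u v ζ) : ℝ) = (1 + normSq ζ) ^ 2 := by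
    simp only [stereoVector, inner_add_left, inner_add_right, real_inner_smul_left,
      real_inner_smul_right, nn, uu, vv, nu, un, nv, vn, uv, vu, normSq_apply]
    ring
  rw [real_inner_self_eq_norm_sq] at h1
  exact (sq_eq_sq₀ (norm_nonneg _) (one_add_normSq_pos ζ).le).1 h1

theorem stereoVector_ne_zero (ζ : ℂ) : stereoVector n u v ζ ≠ 0 := by
  rw [← norm_ne_zero_iff, norm_stereoVector h]
  exact (one_add_normSq_pos ζ).ne'

theorem coe_stereoPoint (ζ : ℂ) :
    (stereoPoint n u v ζ : E3) = (1 + normSq ζ)⁻¹ • stereoVector n u v ζ := by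
  rw [stereoPoint, coe_normalize (stereoVector_ne_zero h ζ), norm_stereoVector h]

theorem continuous_stereoPoint : Continuous (stereoPoint n u v) := by
  refine continuous_iff_continuousAt.2 fun ζ => ?_
  refine ContinuousAt.comp (f := stereoVector n u v)
    (continuousAt_normalize (stereoVector_ne_zero h ζ)) ?_
  unfold stereoVector
  fun_prop

/-- The normalized real and imaginary parts of the null vector form an oriented frame of the
tangent plane. -/
theorem orientedFrame_stereo (ζ : ℂ) : OrientedFrame (stereoPoint n u v ζ : E3)
    ((1 + normSq ζ)⁻¹ • stereoRe n u v ζ) ((1 + normSq ζ)⁻¹ • stereoIm n u v ζ) := by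
  obtain ⟨nn, uu, vv, nu, un, nv, vn, uv, vu⟩ := h.inner_table
  have hs := (one_add_normSq_pos ζ).ne'
  refine ⟨inner_self_sphere _, ?_, ?_, ?_⟩
  · simp only [stereoRe, inner_add_left, inner_add_right, real_inner_smul_left,
      real_inner_smul_right, nn, uu, vv, nu, un, nv, vn, uv, vu]
    field_simp
    simp only [normSq_apply]; ring
  · rw [coe_stereoPoint h]
    simp only [stereoRe, stereoVector, inner_add_left, inner_add_right, real_inner_smul_left,
      real_inner_smul_right, nn, uu, vv, nu, un, nv, vn, uv, vu, normSq_apply]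
    ring
  · have hnu := h.cross_eq
    have hnv := h.cross_thd
    have huv := h.cross_snd_thd
    have hun : cross u n = -v := by rw [cross_swap, hnu]
    have hvn : cross v n = u := by rw [cross_swap, hnv, neg_neg]
    have hvu : cross v u = -n := by rw [cross_swap, huv]
    have key : cross (stereoVector n u v ζ) (stereoRe n u v ζ) =
        (1 + normSq ζ) • stereoIm n u v ζ := by
      simp only [stereoRe, stereoVector, stereoIm, cross_add, add_cross, cross_smul, smul_cross,
        cross_self_eq, hnu, hnv, huv, hun, hvn, hvu, normSq_apply]
      module
    rw [coe_stereoPoint h, cross_smul, smul_cross, key, smul_smul, smul_smul]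
    congr 1
    field_simp

theorem stereoCoord_ne {w : S2} (hw : (w : E3) ≠ -n) : 0 < 1 + (inner ℝ (w : E3) n : ℝ) := by
  have hn : ‖n‖ = 1 := norm_eq_one_of_inner h.norm_fst
  have hw1 : ‖(w : E3)‖ = 1 := by simp
  have h1 : (-1 : ℝ) ≤ inner ℝ (w : E3) n := by
    have := abs_real_inner_le_norm (w : E3) n
    rw [hn, hw1, mul_one] at this
    exact (abs_le.1 this).1
  refine lt_of_le_of_ne (by linarith) fun h0 => hw ?_
  have h2 : (inner ℝ (w : E3) (-n) : ℝ) = 1 := by rw [inner_neg_right]; linarith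
  exact (inner_eq_one_iff_of_norm_eq_one hw1 (by rw [norm_neg, hn])).1 h2

theorem continuousAt_stereoCoord {w : S2} (hw : (w : E3) ≠ -n) :
    ContinuousAt (stereoCoord n u v) w := by
  unfold stereoCoord
  refine ContinuousAt.div (by fun_prop) (by fun_prop) ?_
  exact_mod_cast (stereoCoord_ne h hw).ne'

theorem stereoPoint_stereoCoord {w : S2} (hw : (w : E3) ≠ -n) :
    stereoPoint n u v (stereoCoord n u v w) = w := by
  have hpos := stereoCoord_ne h hw
  have hsum := h.eq_sum (w : E3)
  have h1 : (inner ℝ (w : E3) n : ℝ) ^ 2 + (inner ℝ (w : E3) u : ℝ) ^ 2 +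
      (inner ℝ (w : E3) v : ℝ) ^ 2 = 1 := by
    have h2 := inner_self_sphere w
    nth_rewrite 2 [hsum] at h2
    simp only [inner_add_right, real_inner_smul_right] at h2
    linarith
  set c : ℝ := inner ℝ (w : E3) n
  set x : ℝ := inner ℝ (w : E3) u
  set y : ℝ := inner ℝ (w : E3) v
  have hre : (stereoCoord n u v w).re = x / (1 + c) := by
    rw [stereoCoord, div_ofReal_re]; simp [x, c]
  have him : (stereoCoord n u v w).im = y / (1 + c) := by
    rw [stereoCoord, div_ofReal_im]; simp [y, c]
  have hs : 1 + normSq (stereoCoord n u v w) = 2 / (1 + c) := by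
    rw [normSq_apply, hre, him]; field_simp; linear_combination h1
  have hs' : 1 - normSq (stereoCoord n u v w) = 2 * c / (1 + c) := by
    have : normSq (stereoCoord n u v w) = 2 / (1 + c) - 1 := by linarith
    rw [this]; field_simp; ring
  ext1
  rw [coe_stereoPoint h, hs, stereoVector, hre, him, hs', hsum]
  simp only [smul_add, smul_smul]
  have e1 : (2 / (1 + c))⁻¹ * (2 * (x / (1 + c))) = x := by field_simp
  have e2 : (2 / (1 + c))⁻¹ * (2 * (y / (1 + c))) = y := by field_simp
  have e3 : (2 / (1 + c))⁻¹ * (2 * c / (1 + c)) = c := by field_simp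
  rw [e1, e2, e3]; abel

theorem inner_stereoPoint (ζ : ℂ) : (inner ℝ (stereoPoint n u v ζ : E3) n : ℝ) =
    (1 - normSq ζ) / (1 + normSq ζ) := by
  obtain ⟨nn, uu, vv, nu, un, nv, vn, uv, vu⟩ := h.inner_table
  rw [coe_stereoPoint h]
  simp only [stereoVector, inner_add_left, real_inner_smul_left, nn, un, vn]
  field_simp; ring

theorem stereoPoint_ne (ζ : ℂ) : (stereoPoint n u v ζ : E3) ≠ -n := by
  intro h0
  have h1 := inner_stereoPoint h ζ
  rw [h0, inner_neg_left, h.norm_fst, eq_div_iff (one_add_normSq_pos ζ).ne'] at h1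
  linarith

theorem stereoCoord_stereoPoint (ζ : ℂ) : stereoCoord n u v (stereoPoint n u v ζ) = ζ := by
  obtain ⟨nn, uu, vv, nu, un, nv, vn, uv, vu⟩ := h.inner_table
  have hs := (one_add_normSq_pos ζ).ne'
  have h1 : 1 + (inner ℝ (stereoPoint n u v ζ : E3) n : ℝ) = 2 / (1 + normSq ζ) := by
    rw [inner_stereoPoint h]; field_simp; ring
  rw [stereoCoord, h1, coe_stereoPoint h]
  simp only [stereoVector, inner_add_left, real_inner_smul_left, uu, vu, nu, vv, nv, uv]
  apply Complex.ext
  · rw [div_ofReal_re]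
    simp only [add_re, mul_re, ofReal_re, ofReal_im, I_re, I_im]
    field_simp; ring
  · rw [div_ofReal_im]
    simp only [add_im, mul_im, ofReal_re, ofReal_im, I_re, I_im]
    field_simp; ring

/-- The null vector at `ζ₀` measures the difference of stereographic coordinates from `ζ₀`. -/
theorem inner_stereoRe_add_inner_stereoIm (ζ₀ ζ : ℂ) :
    ((inner ℝ (stereoPoint n u v ζ : E3) (stereoRe n u v ζ₀) : ℝ) : ℂ) +
      (inner ℝ (stereoPoint n u v ζ : E3) (stereoIm n u v ζ₀) : ℝ) * I =
      2 * (ζ - ζ₀) * (1 + starRingEnd ℂ ζ * ζ₀) / (1 + normSq ζ : ℝ) := by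
  obtain ⟨nn, uu, vv, nu, un, nv, vn, uv, vu⟩ := h.inner_table
  have hs : ((1 + normSq ζ : ℝ) : ℂ) ≠ 0 := by exact_mod_cast (one_add_normSq_pos ζ).ne'
  have hs' := (one_add_normSq_pos ζ).ne'
  rw [eq_div_iff hs, coe_stereoPoint h]
  simp only [stereoRe, stereoIm, stereoVector, inner_add_left, inner_add_right,
    real_inner_smul_left, real_inner_smul_right, nn, uu, vv, nu, un, nv, vn, uv, vu]
  apply Complex.ext
  · simp only [mul_re, add_re, ofReal_re, I_re, I_im, ofReal_im, mul_im, add_im, sub_re, sub_im,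
      one_re, one_im, conj_re, conj_im, re_ofNat, im_ofNat]
    field_simp
    simp only [normSq_apply]
    ring
  · simp only [mul_re, add_re, ofReal_re, I_re, I_im, ofReal_im, mul_im, add_im, sub_re, sub_im,
      one_re, one_im, conj_re, conj_im, re_ofNat, im_ofNat]
    field_simp
    simp only [normSq_apply]
    ring

/-- The coordinate `ζ = ∞` belongs to the pole `-n`. -/
theorem tendsto_stereoPoint {w : S2} (hw : (w : E3) = -n) :
    Tendsto (stereoPoint n u v) (cocompact ℂ) (𝓝 w) := by
  rw [tendsto_iff_dist_tendsto_zero]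
  have h1 : ∀ ζ, dist (stereoPoint n u v ζ) w = Real.sqrt (4 / (1 + ‖ζ‖ ^ 2)) := by
    intro ζ
    have hs := (one_add_normSq_pos ζ).ne'
    rw [← Real.sqrt_sq (dist_nonneg (x := stereoPoint n u v ζ) (y := w))]
    congr 1
    rw [Subtype.dist_eq, dist_eq_norm, hw, sub_neg_eq_add, norm_add_sq_real, inner_stereoPoint h,
      norm_eq_one_of_inner h.norm_fst, norm_eq_one_of_inner (inner_self_sphere _),
      ← normSq_eq_norm_sq]
    field_simp; ring
  simp only [h1]
  have h2 : Tendsto (fun ζ : ℂ => 1 + ‖ζ‖ ^ 2) (cocompact ℂ) atTop :=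
    tendsto_atTop_add_const_left _ _
      ((tendsto_pow_atTop two_ne_zero).comp (tendsto_norm_cocompact_atTop (E := ℂ)))
  have h3 := (Real.continuous_sqrt.tendsto 0).comp (h2.const_div_atTop 4)
  rwa [Real.sqrt_zero] at h3

end Stereo

/-! ### The defect in stereographic coordinates -/

namespace GlobalSection

variable (V : GlobalSection)

/-- The section `δ⁺f ∧ δ⁻f` read in the stereographic coordinate `ζ`, in the trivialization given by
the null vector `(1 - ζ²) u + i (1 + ζ²) v - 2 ζ n`. -/
noncomputable def stereoDefect (n u v : E3) (ζ : ℂ) : ℂ :=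
  ((1 + normSq ζ : ℝ) : ℂ) ^ 2 * V.complexDefect (stereoPoint n u v ζ)
    ((1 + normSq ζ)⁻¹ • stereoRe n u v ζ) ((1 + normSq ζ)⁻¹ • stereoIm n u v ζ)

variable {n u v : E3} (h : OrientedFrame n u v)

include h

theorem stereoDefect_eq (ζ : ℂ) : V.stereoDefect n u v ζ =
    (((inner ℝ (V.D (stereoPoint n u v ζ) (stereoRe n u v ζ)) (stereoRe n u v ζ) -
        inner ℝ (V.D (stereoPoint n u v ζ) (stereoIm n u v ζ)) (stereoIm n u v ζ) : ℝ) : ℂ) +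
      ((inner ℝ (V.D (stereoPoint n u v ζ) (stereoRe n u v ζ)) (stereoIm n u v ζ) +
        inner ℝ (V.D (stereoPoint n u v ζ) (stereoIm n u v ζ)) (stereoRe n u v ζ) : ℝ) : ℂ) * I)
      / 2 := by
  have hs : ((1 + normSq ζ : ℝ) : ℂ) ≠ 0 := by exact_mod_cast (one_add_normSq_pos ζ).ne'
  rw [stereoDefect, V.complexDefect_eq _ (orientedFrame_stereo h ζ)]
  simp only [map_smul, real_inner_smul_left, real_inner_smul_right]
  generalize 1 + normSq ζ = s at *
  push_cast
  field_simp

theorem continuous_stereoDefect : Continuous (V.stereoDefect n u v) := by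
  have h1 : Continuous fun ζ => V.D (stereoPoint n u v ζ) :=
    V.continuous_D.comp (continuous_stereoPoint h)
  have h2 : Continuous (stereoRe n u v) := by unfold stereoRe; fun_prop
  have h3 : Continuous (stereoIm n u v) := by unfold stereoIm; fun_prop
  have h4 := h1.clm_apply h2
  have h5 := h1.clm_apply h3
  rw [funext (V.stereoDefect_eq h)]
  fun_prop

theorem stereoDefect_eq_zero_iff (ζ : ℂ) :
    V.stereoDefect n u v ζ = 0 ↔ V.IsComplexPoint (stereoPoint n u v ζ) := by
  have hs : ((1 + normSq ζ : ℝ) : ℂ) ≠ 0 := by exact_mod_cast (one_add_normSq_pos ζ).ne'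
  rw [V.isComplexPoint_iff_complexDefect _ (orientedFrame_stereo h ζ), stereoDefect,
    mul_eq_zero, or_iff_right (pow_ne_zero 2 hs)]

/-- The defect is the value of a complex quadratic form on the null vector. -/
theorem stereoDefect_eq_sum (ζ : ℂ) : V.stereoDefect n u v ζ =
    (∑ j : Fin 3, ∑ k : Fin 3,
      ((inner ℝ (V.D (stereoPoint n u v ζ) (![u, v, n] j)) (![u, v, n] k) : ℝ) : ℂ) *
      (![1 - ζ ^ 2, I * (1 + ζ ^ 2), -2 * ζ] j * ![1 - ζ ^ 2, I * (1 + ζ ^ 2), -2 * ζ] k)) / 2 := by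
  rw [V.stereoDefect_eq h]
  simp only [stereoRe, stereoIm, map_add, map_smul, inner_add_left, inner_add_right,
    real_inner_smul_left, real_inner_smul_right, Fin.sum_univ_three, Matrix.cons_val]
  generalize V.D (stereoPoint n u v ζ) = T
  obtain ⟨x, y⟩ := ζ
  congr 1
  apply Complex.ext
  · simp [pow_two]; ring
  · simp [pow_two]; ring

/-- At infinity the defect grows like the fourth power of the coordinate: the bundle in which it
takes its values has degree `4`. -/
theorem tendsto_stereoDefect {w : S2} (hw : (w : E3) = -n) :
    Tendsto (fun ζ => V.stereoDefect n u v ζ / ζ ^ (4 : ℤ)) (cocompact ℂ)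
      (𝓝 (V.complexDefect w u (-v))) := by
  have hfr : OrientedFrame (w : E3) u (-v) := hw ▸ h.neg
  have hinv : Tendsto (fun z : ℂ => z⁻¹) (cocompact ℂ) (𝓝 0) :=
    tendsto_inv₀_cobounded.mono_left (Metric.cobounded_eq_cocompact (α := ℂ)).ge
  have hm : ∀ j : Fin 3, Tendsto
      (fun ζ : ℂ => ![ζ⁻¹ ^ 2 - 1, I * (ζ⁻¹ ^ 2 + 1), -2 * ζ⁻¹] j) (cocompact ℂ)
      (𝓝 (![-1, I, 0] j)) := by
    intro j
    fin_cases j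
    · simpa using (hinv.pow 2).sub_const 1
    · simpa using ((hinv.pow 2).add_const 1).const_mul I
    · simpa using hinv.const_mul (-2)
  have hd : ∀ j k : Fin 3, Tendsto (fun ζ : ℂ =>
      ((inner ℝ (V.D (stereoPoint n u v ζ) (![u, v, n] j)) (![u, v, n] k) : ℝ) : ℂ))
      (cocompact ℂ) (𝓝 ((inner ℝ (V.D w (![u, v, n] j)) (![u, v, n] k) : ℝ) : ℂ)) := by
    intro j k
    have hc : Continuous fun w : S2 =>
        ((inner ℝ (V.D w (![u, v, n] j)) (![u, v, n] k) : ℝ) : ℂ) := by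
      have := V.continuous_D.clm_apply (continuous_const (y := ![u, v, n] j))
      fun_prop
    exact (hc.tendsto w).comp (tendsto_stereoPoint h hw)
  have hlim := (tendsto_finsetSum Finset.univ fun j _ => tendsto_finsetSum Finset.univ fun k _ =>
    (hd j k).mul ((hm j).mul (hm k))).div_const 2
  have hval : V.complexDefect w u (-v) = (∑ j : Fin 3, ∑ k : Fin 3,
      ((inner ℝ (V.D w (![u, v, n] j)) (![u, v, n] k) : ℝ) : ℂ) *
        (![-1, I, 0] j * ![-1, I, 0] k)) / 2 := by
    rw [V.complexDefect_eq w hfr]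
    simp only [map_neg, inner_neg_left, inner_neg_right, Fin.sum_univ_three, Matrix.cons_val]
    push_cast
    linear_combination (-(1 / 2 : ℂ) * (inner ℝ (V.D w v) v : ℝ)) * I_sq
  rw [hval]
  refine hlim.congr' ?_
  filter_upwards [(isCompact_singleton (x := (0 : ℂ))).compl_mem_cocompact] with ζ h0
  have h0 : ζ ≠ 0 := by simpa using h0
  rw [V.stereoDefect_eq_sum h]
  simp only [Fin.sum_univ_three, Matrix.cons_val]
  field_simp

end GlobalSection

/-! ### Small circles on the sphere -/

theorem circleAround_vector_ne_zero {w₀ : S2} {a b : E3} (h : OrientedFrame (w₀ : E3) a b)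
    (ε t : ℝ) : (w₀ : E3) + ε • (Real.cos t • a + Real.sin t • b) ≠ 0 := by
  intro h0
  have h1 := congrArg (fun x => (inner ℝ (w₀ : E3) x : ℝ)) h0
  simp only [inner_add_right, real_inner_smul_right, h.orthogonal, h.inner_fst_thd,
    inner_self_sphere, inner_zero_right] at h1
  norm_num at h1

theorem continuous_circleAround {w₀ : S2} {a b : E3} (h : OrientedFrame (w₀ : E3) a b) (ε : ℝ) :
    Continuous (circleAround w₀ a b ε) := by
  refine continuous_iff_continuousAt.2 fun t => ?_
  exact ContinuousAt.comp
    (f := fun t : ℝ => (w₀ : E3) + ε • (Real.cos t • a + Real.sin t • b))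
    (continuousAt_normalize (circleAround_vector_ne_zero h ε t)) (by fun_prop)

theorem eventually_forall_circleAround {w₀ : S2} (a b : E3) {P : S2 → Prop}
    (hP : ∀ᶠ w in 𝓝 w₀, P w) : ∀ᶠ ε in 𝓝[>] (0 : ℝ), ∀ t, P (circleAround w₀ a b ε t) := by
  have h1 : ∀ᶠ y in 𝓝 (w₀ : E3), P (normalize y) := by
    have := continuousAt_normalize (sphere_ne_zero w₀)
    rw [ContinuousAt, normalize_coe] at this
    exact this.eventually hP
  obtain ⟨r, hr, hball⟩ := Metric.eventually_nhds_iff.1 h1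
  have hc : 0 < r / (‖a‖ + ‖b‖ + 1) := by positivity
  filter_upwards [Ioo_mem_nhdsGT hc] with ε hε t
  refine hball ?_
  have h2 : ‖Real.cos t • a + Real.sin t • b‖ ≤ ‖a‖ + ‖b‖ := by
    refine (norm_add_le _ _).trans (add_le_add ?_ ?_)
    · rw [norm_smul]
      exact mul_le_of_le_one_left (norm_nonneg _) (Real.abs_cos_le_one t)
    · rw [norm_smul]
      exact mul_le_of_le_one_left (norm_nonneg _) (Real.abs_sin_le_one t)
  rw [dist_self_add_left, norm_smul, Real.norm_of_nonneg hε.1.le]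
  calc ε * ‖Real.cos t • a + Real.sin t • b‖ ≤ ε * (‖a‖ + ‖b‖) :=
        mul_le_mul_of_nonneg_left h2 hε.1.le
    _ ≤ ε * (‖a‖ + ‖b‖ + 1) := by nlinarith [hε.1]
    _ < r := (lt_div_iff₀ (by positivity)).1 hε.2

theorem circleAround_two_pi (w₀ : S2) (a b : E3) (ε : ℝ) :
    circleAround w₀ a b ε (2 * Real.pi) = circleAround w₀ a b ε 0 := by
  simp [circleAround]

section Stereo

variable {n u v : E3} (h : OrientedFrame n u v)

include h

theorem stereo_cross (ζ : ℂ) :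
    cross (stereoPoint n u v ζ : E3) (stereoRe n u v ζ) = stereoIm n u v ζ ∧
    cross (stereoPoint n u v ζ : E3) (stereoIm n u v ζ) = -stereoRe n u v ζ := by
  have hs := inv_ne_zero (one_add_normSq_pos ζ).ne'
  have hf := orientedFrame_stereo h ζ
  have h1 := hf.cross_eq
  have h2 := hf.cross_thd
  rw [cross_smul] at h1 h2
  rw [← smul_neg] at h2
  exact ⟨smul_right_injective _ hs h1, smul_right_injective _ hs h2⟩

theorem stereo_orthogonal (ζ : ℂ) :
    (inner ℝ (stereoPoint n u v ζ : E3) (stereoRe n u v ζ) : ℝ) = 0 ∧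
    (inner ℝ (stereoPoint n u v ζ : E3) (stereoIm n u v ζ) : ℝ) = 0 := by
  obtain ⟨h1, h2⟩ := stereo_cross h ζ
  constructor
  · rw [real_inner_comm, ← neg_eq_iff_eq_neg.2 h2, inner_neg_left, inner_cross_self_left, neg_zero]
  · rw [real_inner_comm, ← h1, inner_cross_self_left]

/-- The null vector pairs nontrivially with every unit tangent vector. -/
theorem stereo_pairing_ne_zero {ζ : ℂ} {a b : E3}
    (hf : OrientedFrame (stereoPoint n u v ζ : E3) a b) (c : ℂ) (hc : c = I ∨ c = -I) :
    ((inner ℝ a (stereoRe n u v ζ) : ℝ) : ℂ) + (inner ℝ a (stereoIm n u v ζ) : ℝ) * c ≠ 0 := by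
  intro h0
  have hre : (inner ℝ a (stereoRe n u v ζ) : ℝ) = 0 := by
    have := congrArg Complex.re h0
    rcases hc with rfl | rfl <;> simpa using this
  have him : (inner ℝ a (stereoIm n u v ζ) : ℝ) = 0 := by
    have := congrArg Complex.im h0
    rcases hc with rfl | rfl <;> simpa using this
  have h1 := (orientedFrame_stereo h ζ).eq_sum a
  have h2 : (inner ℝ a (stereoPoint n u v ζ : E3) : ℝ) = 0 := by
    rw [real_inner_comm, hf.orthogonal]
  rw [h2, real_inner_smul_right, real_inner_smul_right, hre, him] at h1
  have h3 := hf.norm_snd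
  rw [h1] at h3
  simp at h3

/-- On a circle around the point with coordinate `ζ₀`, the pairing with the null vector turns
uniformly. -/
theorem inner_circleAround {ζ₀ : ℂ} {a b : E3}
    (hf : OrientedFrame (stereoPoint n u v ζ₀ : E3) a b) (ε t : ℝ) :
    ((inner ℝ (circleAround (stereoPoint n u v ζ₀) a b ε t : E3) (stereoRe n u v ζ₀) : ℝ) : ℂ) +
      (inner ℝ (circleAround (stereoPoint n u v ζ₀) a b ε t : E3) (stereoIm n u v ζ₀) : ℝ) * I =
    ((ε / ‖(stereoPoint n u v ζ₀ : E3) + ε • (Real.cos t • a + Real.sin t • b)‖ : ℝ) : ℂ) *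
      (((inner ℝ a (stereoRe n u v ζ₀) : ℝ) : ℂ) + (inner ℝ a (stereoIm n u v ζ₀) : ℝ) * I) *
      exp (t * I) := by
  obtain ⟨h1, h2⟩ := stereo_orthogonal h ζ₀
  obtain ⟨h3, h4⟩ := stereo_cross h ζ₀
  have h5 : (inner ℝ b (stereoRe n u v ζ₀) : ℝ) = -inner ℝ a (stereoIm n u v ζ₀) := by
    rw [← hf.cross_eq, inner_cross_comm, h3]
  have h6 : (inner ℝ b (stereoIm n u v ζ₀) : ℝ) = inner ℝ a (stereoRe n u v ζ₀) := by
    rw [← hf.cross_eq, inner_cross_comm, h4, inner_neg_right, neg_neg]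
  rw [circleAround, coe_normalize (circleAround_vector_ne_zero hf ε t), exp_mul_I,
    ← ofReal_cos, ← ofReal_sin]
  simp only [real_inner_smul_left, inner_add_left, h1, h2, h5, h6]
  generalize ‖(stereoPoint n u v ζ₀ : E3) + ε • (Real.cos t • a + Real.sin t • b)‖ = N
  push_cast
  linear_combination (-(ε / N) * sin (t : ℂ) * (inner ℝ a (stereoIm n u v ζ₀) : ℝ)) * I_sq

end Stereo

namespace GlobalSection

variable (V : GlobalSection)

/-- The winding number of `δ⁺f ∧ δ⁻f` along small circles on the sphere, read in any oriented
orthonormal frame, is the index of the coordinate expression: the circles wind once around the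
point in the stereographic coordinate, and the change of frame is nearly constant on them. -/
theorem eventually_hasWindingNumber {n u v : E3} (h : OrientedFrame n u v) {ζ₀ : ℂ} {k : ℤ}
    (hind : HasLocalIndex (V.stereoDefect n u v) ζ₀ k) {a b : S2 → E3}
    (hf : IsTangentFrame (stereoPoint n u v ζ₀) a b) :
    ∀ᶠ ε in 𝓝[>] (0 : ℝ), HasWindingNumber (fun t =>
      let w := circleAround (stereoPoint n u v ζ₀) (a (stereoPoint n u v ζ₀))
        (b (stereoPoint n u v ζ₀)) ε t
      V.complexDefect w (a w) (b w)) k := by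
  set w₀ := stereoPoint n u v ζ₀ with hw₀
  set p := stereoCoord n u v with hp
  have hpw₀ : p w₀ = ζ₀ := stereoCoord_stereoPoint h ζ₀
  have hf₀ : OrientedFrame (w₀ : E3) (a w₀) (b w₀) := hf.orientedFrame.self_of_nhds
  -- The point `-n` is far away.
  have hpole : ∀ᶠ w : S2 in 𝓝 w₀, (w : E3) ≠ -n :=
    continuous_subtype_val.continuousAt.eventually_ne (stereoPoint_ne h ζ₀)
  have hpcont : ∀ᶠ w in 𝓝 w₀, ContinuousAt p w :=
    hpole.mono fun w hw => continuousAt_stereoCoord h hw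
  have hden : ∀ ζ : ℂ, ((1 + normSq ζ : ℝ) : ℂ) ≠ 0 := fun ζ => by
    exact_mod_cast (one_add_normSq_pos ζ).ne'
  -- The change of frame, with the normalization of the null vector.
  set κ : S2 → ℂ := fun w => (((inner ℝ (a w) (stereoRe n u v (p w)) : ℝ) : ℂ) +
    (inner ℝ (a w) (stereoIm n u v (p w)) : ℝ) * -I) / ((1 + normSq (p w) : ℝ) : ℂ) ^ 2 with hκ
  have hκ₀ : κ w₀ ≠ 0 := by
    simp only [hκ, hpw₀]
    exact div_ne_zero (stereo_pairing_ne_zero h hf₀ _ (Or.inr rfl)) (pow_ne_zero 2 (hden ζ₀))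
  have hκcont : ∀ᶠ w in 𝓝 w₀, ContinuousAt κ w := by
    filter_upwards [hpcont, hf.continuous_fst] with w h1 h2
    have h3 : Continuous (stereoRe n u v) := by unfold stereoRe; fun_prop
    have h4 : Continuous (stereoIm n u v) := by unfold stereoIm; fun_prop
    have h5 : ContinuousAt (fun w => stereoRe n u v (p w)) w := h3.continuousAt.comp h1
    have h6 : ContinuousAt (fun w => stereoIm n u v (p w)) w := h4.continuousAt.comp h1
    have h7 : ContinuousAt (fun w => normSq (p w)) w :=
      continuous_normSq.continuousAt.comp h1
    refine ContinuousAt.div (by fun_prop) (by fun_prop) (pow_ne_zero 2 (hden _))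
  have hκslit : ∀ᶠ w in 𝓝 w₀, κ w / κ w₀ ∈ slitPlane := by
    have : ContinuousAt (fun w => κ w / κ w₀) w₀ := hκcont.self_of_nhds.div_const _
    exact this.eventually_mem (isOpen_slitPlane.mem_nhds (by simp [hκ₀]))
  have hdefect : ∀ᶠ w in 𝓝 w₀, V.complexDefect w (a w) (b w) =
      κ w ^ 2 * V.stereoDefect n u v (p w) := by
    filter_upwards [hpole, hf.orientedFrame] with w h1 h2
    have h3 := orientedFrame_stereo h (p w)
    have h4 : stereoPoint n u v (p w) = w := stereoPoint_stereoCoord h h1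
    rw [h4] at h3
    rw [V.complexDefect_change w h3 h2, stereoDefect, h4]
    simp only [hκ, real_inner_smul_right]
    have := hden (p w)
    generalize 1 + normSq (p w) = s at *
    push_cast
    field_simp
    ring
  -- The factor between the pairing with the null vector and the coordinate difference.
  set τ : S2 → ℂ := fun w => ((1 + normSq (p w) : ℝ) : ℂ) /
    (2 * (1 + starRingEnd ℂ (p w) * ζ₀)) with hτ
  have hconj : starRingEnd ℂ ζ₀ * ζ₀ = (normSq ζ₀ : ℂ) := by rw [mul_comm, mul_conj]
  have hτden : ∀ᶠ w in 𝓝 w₀, 1 + starRingEnd ℂ (p w) * ζ₀ ≠ 0 := by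
    have hc : ContinuousAt (fun w => 1 + starRingEnd ℂ (p w) * ζ₀) w₀ := by
      have := hpcont.self_of_nhds
      fun_prop
    refine hc.eventually_ne ?_
    rw [hpw₀, hconj]
    simpa using hden ζ₀
  have hτcont : ∀ᶠ w in 𝓝 w₀, ContinuousAt τ w := by
    filter_upwards [hpcont, hτden] with w h1 h2
    have h7 : ContinuousAt (fun w => normSq (p w)) w :=
      continuous_normSq.continuousAt.comp h1
    exact ContinuousAt.div (by fun_prop) (by fun_prop) (mul_ne_zero two_ne_zero h2)
  have hτslit : ∀ᶠ w in 𝓝 w₀, τ w ∈ slitPlane := by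
    refine hτcont.self_of_nhds.eventually_mem (isOpen_slitPlane.mem_nhds ?_)
    have : τ w₀ = ((1 / 2 : ℝ) : ℂ) := by
      have h1 := hden ζ₀
      simp only [hτ, hpw₀, hconj]
      push_cast at h1 ⊢
      field_simp
    rw [this, ofReal_mem_slitPlane]
    norm_num
  have hcoord : ∀ᶠ w in 𝓝 w₀, p w - ζ₀ = (((inner ℝ (w : E3) (stereoRe n u v ζ₀) : ℝ) : ℂ) +
      (inner ℝ (w : E3) (stereoIm n u v ζ₀) : ℝ) * I) * τ w := by
    filter_upwards [hpole, hτden] with w h1 h2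
    have h3 := inner_stereoRe_add_inner_stereoIm h ζ₀ (p w)
    rw [stereoPoint_stereoCoord h h1] at h3
    rw [h3]
    simp only [hτ]
    rw [div_mul_div_comm,
      eq_div_iff (mul_ne_zero (hden (p w)) (mul_ne_zero two_ne_zero h2))]
    ring
  obtain ⟨ρ, hρ⟩ := hind.exists_log_along
  have hsmall : ∀ᶠ w in 𝓝 w₀, ‖p w - ζ₀‖ < Real.exp ρ := by
    have hc : ContinuousAt (fun w => ‖p w - ζ₀‖) w₀ := by
      have := hpcont.self_of_nhds
      fun_prop
    exact hc.eventually_lt_const (by simp [hpw₀, Real.exp_pos])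
  filter_upwards [self_mem_nhdsWithin, eventually_forall_circleAround (a w₀) (b w₀)
    (hκcont.and <| hκslit.and <| hdefect.and <| hτcont.and <| hτslit.and <|
      hcoord.and hsmall)] with ε hε H
  have hε : 0 < ε := hε
  set c : ℝ → S2 := circleAround w₀ (a w₀) (b w₀) ε with hc
  have hcc : Continuous c := continuous_circleAround hf₀ ε
  have hper : c (2 * Real.pi) = c 0 := circleAround_two_pi _ _ _ _
  set N : ℝ → ℝ := fun t => ε / ‖(w₀ : E3) + ε • (Real.cos t • a w₀ + Real.sin t • b w₀)‖ with hN
  have hNpos : ∀ t, 0 < N t := fun t =>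
    div_pos hε (norm_pos_iff.2 (circleAround_vector_ne_zero hf₀ ε t))
  have hNcont : Continuous N := by
    refine Continuous.div (by fun_prop) (by fun_prop) fun t => ?_
    exact norm_ne_zero_iff.2 (circleAround_vector_ne_zero hf₀ ε t)
  have hNper : N (2 * Real.pi) = N 0 := by simp [hN]
  set β : ℂ := ((inner ℝ (a w₀) (stereoRe n u v ζ₀) : ℝ) : ℂ) +
    (inner ℝ (a w₀) (stereoIm n u v ζ₀) : ℝ) * I with hβ
  have hβ0 : β ≠ 0 := stereo_pairing_ne_zero h hf₀ _ (Or.inl rfl)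
  -- A logarithm of the coordinate difference along the circle.
  set σ : ℝ → ℂ := fun t => (Real.log (N t) : ℂ) + log β + t * I + log (τ (c t)) with hσ
  have hσexp : ∀ t, exp (σ t) = p (c t) - ζ₀ := by
    intro t
    obtain ⟨-, -, -, -, h5, h6, -⟩ := H t
    rw [h6, inner_circleAround h hf₀ ε t]
    simp only [hσ, Complex.exp_add]
    rw [exp_log hβ0, exp_log (slitPlane_ne_zero h5), ← ofReal_exp, Real.exp_log (hNpos t)]
  have hτc : Continuous fun t => log (τ (c t)) := by
    refine continuous_iff_continuousAt.2 fun t => ?_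
    obtain ⟨-, -, -, h4, h5, -, -⟩ := H t
    exact ContinuousAt.clog (ContinuousAt.comp (f := c) h4 hcc.continuousAt) h5
  have hκc : Continuous fun t => log (κ (c t) / κ w₀) := by
    refine continuous_iff_continuousAt.2 fun t => ?_
    obtain ⟨h1, h2, -⟩ := H t
    exact ContinuousAt.clog ((ContinuousAt.comp (f := c) h1 hcc.continuousAt).div_const _) h2
  have hσc : Continuous σ := by
    have : Continuous fun t => Real.log (N t) := hNcont.log fun t => (hNpos t).ne'
    fun_prop
  obtain ⟨L, hL, hLexp, hLper⟩ := hρ σ hσc (fun t => by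
    obtain ⟨-, -, -, -, -, -, h7⟩ := H t
    rw [← hσexp, norm_exp] at h7
    exact Real.exp_lt_exp.1 h7) (by
    simp only [hσ, hper, hNper]
    push_cast; ring)
  refine HasWindingNumber.of_exp
    (L := fun t => L t + 2 * log (κ w₀) + 2 * log (κ (c t) / κ w₀)) (by fun_prop) (fun t => ?_) ?_
  · obtain ⟨-, h2, h3, -⟩ := H t
    have h4 : ∀ z : ℂ, exp (2 * z) = exp z ^ 2 := fun z => by rw [← exp_nat_mul]; norm_num
    rw [Complex.exp_add, Complex.exp_add, h4, h4, exp_log hκ₀, exp_log (slitPlane_ne_zero h2),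
      ← hLexp, hσexp, add_sub_cancel]
    refine h3.trans ?_
    field_simp
  · simp only [hper, hLper]; ring

/-- The frame given by stereographic coordinates. -/
theorem isTangentFrame_stereo {n u v : E3} (h : OrientedFrame n u v) (ζ₀ : ℂ) :
    IsTangentFrame (stereoPoint n u v ζ₀)
      (fun w => (1 + normSq (stereoCoord n u v w))⁻¹ • stereoRe n u v (stereoCoord n u v w))
      (fun w => (1 + normSq (stereoCoord n u v w))⁻¹ •
        stereoIm n u v (stereoCoord n u v w)) := by
  have hpole : ∀ᶠ w : S2 in 𝓝 (stereoPoint n u v ζ₀), (w : E3) ≠ -n :=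
    continuous_subtype_val.continuousAt.eventually_ne (stereoPoint_ne h ζ₀)
  have hinv : Continuous fun ζ : ℂ => (1 + normSq ζ)⁻¹ :=
    (continuous_const.add continuous_normSq).inv₀ fun ζ => (one_add_normSq_pos ζ).ne'
  have hre : Continuous fun ζ : ℂ => (1 + normSq ζ)⁻¹ • stereoRe n u v ζ :=
    hinv.smul (by unfold stereoRe; fun_prop)
  have him : Continuous fun ζ : ℂ => (1 + normSq ζ)⁻¹ • stereoIm n u v ζ :=
    hinv.smul (by unfold stereoIm; fun_prop)
  have hfr : ∀ w : S2, (w : E3) ≠ -n → OrientedFrame (w : E3)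
      ((1 + normSq (stereoCoord n u v w))⁻¹ • stereoRe n u v (stereoCoord n u v w))
      ((1 + normSq (stereoCoord n u v w))⁻¹ • stereoIm n u v (stereoCoord n u v w)) := by
    intro w hw
    have h3 := orientedFrame_stereo h (stereoCoord n u v w)
    rwa [stereoPoint_stereoCoord h hw] at h3
  exact ⟨hpole.mono fun w hw => ContinuousAt.comp (f := stereoCoord n u v) hre.continuousAt
      (continuousAt_stereoCoord h hw),
    hpole.mono fun w hw => ContinuousAt.comp (f := stereoCoord n u v) him.continuousAt
      (continuousAt_stereoCoord h hw),
    hpole.mono fun w hw => (hfr w hw).orthonormal, hpole.mono fun w hw => (hfr w hw).cross_eq⟩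

theorem hasIndex_iff {n u v : E3} (h : OrientedFrame n u v) {ζ₀ : ℂ} {k : ℤ}
    (hind : HasLocalIndex (V.stereoDefect n u v) ζ₀ k) (m : ℤ) :
    V.HasIndex (stereoPoint n u v ζ₀) m ↔ m = k := by
  constructor
  · rintro ⟨a, b, hf, hm⟩
    obtain ⟨ε, h1, h2⟩ := (hm.and (V.eventually_hasWindingNumber h hind hf)).exists
    exact h1.unique h2
  · rintro rfl
    obtain ⟨a, b, hf⟩ : ∃ a b, IsTangentFrame (stereoPoint n u v ζ₀) a b :=
      ⟨_, _, isTangentFrame_stereo h ζ₀⟩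
    exact ⟨a, b, hf, V.eventually_hasWindingNumber h hind hf⟩

/-- The sphere is infinite, so some pole avoids a finite set of points. -/
theorem exists_orientedFrame_neg_notMem {S : Set S2} (hS : S.Finite) :
    ∃ (n u v : E3) (w : S2), OrientedFrame n u v ∧ (w : E3) = -n ∧ w ∉ S := by
  have hinf : Infinite S2 := by
    obtain ⟨n, u, v, hf⟩ : ∃ n u v : E3, OrientedFrame n u v := by
      obtain ⟨a, b, h⟩ := exists_orientedFrame (normalize 0)
      exact ⟨_, a, b, h⟩
    exact Infinite.of_injective (stereoPoint n u v) fun ζ ζ' heq => by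
      rw [← stereoCoord_stereoPoint hf ζ, heq, stereoCoord_stereoPoint hf]
  obtain ⟨w, hw⟩ := hS.infinite_compl.nonempty
  obtain ⟨u, v, hf⟩ := exists_orientedFrame (-w)
  exact ⟨_, u, v, w, hf, by simp, hw⟩

/-- The indices of the shear-free lines exist and add up to `4`, if these lines are isolated. -/
theorem exists_index (V : GlobalSection) (hisol : DiscreteTopology (shearFreeLines V.graph)) :
    ∃ ind : OrientedLine → ℤ,
      (∀ γ ∈ shearFreeLines V.graph, ∀ n : ℤ, V.HasIndex γ.direction n ↔ n = ind γ) ∧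
      ∑ᶠ γ ∈ shearFreeLines V.graph, ind γ = 4 := by
  have hfin : {w | V.IsComplexPoint w}.Finite := V.finite_isComplexPoint hisol
  have heq := V.shearFreeLines_eq
  -- The pole `-n` of the coordinate is chosen away from the complex points.
  obtain ⟨n, u, v, w, h, hw, hwS⟩ := exists_orientedFrame_neg_notMem hfin
  have hne : ∀ w' : S2, V.IsComplexPoint w' → (w' : E3) ≠ -n := by
    rintro w' hw' h0
    exact hwS (by rwa [Subtype.ext (h0.trans hw.symm)] at hw')
  have hZ : (stereoCoord n u v '' {w | V.IsComplexPoint w}).Finite := hfin.image _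
  have hzero : ∀ ζ, V.stereoDefect n u v ζ = 0 ↔
      ζ ∈ stereoCoord n u v '' {w | V.IsComplexPoint w} := by
    intro ζ
    rw [V.stereoDefect_eq_zero_iff h]
    constructor
    · exact fun hζ => ⟨_, hζ, stereoCoord_stereoPoint h ζ⟩
    · rintro ⟨w', hw', rfl⟩
      rwa [stereoPoint_stereoCoord h (hne w' hw')]
  have hcont := V.continuous_stereoDefect h
  have hind : ∀ ζ : ℂ, ∃ k, HasLocalIndex (V.stereoDefect n u v) ζ k := by
    intro ζ
    refine exists_hasLocalIndex ?_
    have h1 := (hZ.subset (Set.sdiff_subset (t := {ζ}))).isClosed.isOpen_compl.mem_nhds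
      (x := ζ) (by simp)
    filter_upwards [nhdsWithin_le_nhds h1, self_mem_nhdsWithin] with ζ' h2 h3
    exact ⟨hcont.continuousAt, fun h4 => h2 ⟨(hzero ζ').1 h4, h3⟩⟩
  choose k hk using hind
  refine ⟨fun γ => k (stereoCoord n u v γ.direction), ?_, ?_⟩
  · rw [heq]
    rintro - ⟨w', hw', rfl⟩ m
    have h1 := V.hasIndex_iff h (hk (stereoCoord n u v w')) m
    rwa [stereoPoint_stereoCoord h (hne w' hw')] at h1
  · have hinj : Set.InjOn (stereoCoord n u v) {w | V.IsComplexPoint w} := by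
      intro w₁ h₁ w₂ h₂ h12
      rw [← stereoPoint_stereoCoord h (hne w₁ h₁), h12, stereoPoint_stereoCoord h (hne w₂ h₂)]
    rw [heq, finsum_mem_image V.line_injective.injOn]
    change ∑ᶠ w' ∈ {w | V.IsComplexPoint w}, k (stereoCoord n u v w') = 4
    rw [← finsum_mem_image (f := k) hinj, finsum_mem_eq_finite_toFinset_sum _ hZ]
    refine sum_localIndex_eq hcont.continuousOn (fun ζ hζ => ?_) (fun ζ _ => hk ζ) ?_
      (V.tendsto_stereoDefect h hw)
    · rw [Ne, hzero]; simpa using hζ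
    · exact fun h0 => hwS ((V.isComplexPoint_iff_complexDefect w (hw ▸ h.neg)).2 h0)

end GlobalSection

end LineCongruence

theorem theorem3 (V : LineCongruence.GlobalSection)
    (hisol : DiscreteTopology (LineCongruence.shearFreeLines V.graph)) :
    (∀ w : LineCongruence.S2,
      V.line w ∈ LineCongruence.shearFreeLines V.graph ↔ V.IsComplexPoint w) ∧
    (LineCongruence.shearFreeLines V.graph).Finite ∧
    ∃ ind : LineCongruence.OrientedLine → ℤ,
      (∀ γ ∈ LineCongruence.shearFreeLines V.graph, ∀ n : ℤ,
        V.HasIndex γ.direction n ↔ n = ind γ) ∧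
      ∑ᶠ γ ∈ LineCongruence.shearFreeLines V.graph, ind γ = 4 := by
  refine ⟨V.line_mem_shearFreeLines_iff, ?_, V.exists_index hisol⟩
  rw [V.shearFreeLines_eq]
  exact (V.finite_isComplexPoint hisol).image _
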